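/- Let $\Omega\subset\mathbb R^d$ ($d\ge 1$) be open and bounded, let $\varepsilon,\gamma>0$ and $F(u)=\frac14(u^2-1)^2$, write $\|\cdot\|$ for the norm of $L^2(\Omega)$, and let $$E(t)=\int_\Omega\Big(\frac{\varepsilon^2}{2}|\nabla u(t,x)|^2+F(u(t,x))\Big)\,dx .$$ For $\alpha\in(0,1)$, a global solution of the time-fractional Cahn--Hilliard (TFCH) equation $$\partial_t^\alpha u=\gamma\,\Delta\big(-\varepsilon^2\Delta u+F'(u)\big)\quad\text{in }\Omega,\ t>0,\qquad \partial_t^\alpha u(t)=\frac1{\Gamma(1-\alpha)}\int_0^t\frac{\partial_\tau u(\tau)}{(t-\tau)^\alpha}\,d\tau ,$$ with homogeneous Dirichlet boundary condition is a function $u\in C([0,\infty);L^2(\Omega))\cap C^1((0,\infty);L^2(\Omega))$ such that for every $T>0$ there is $C_T$ with $\|\partial_tu(t)\|\le C_Tt^{\alpha-1}$ on $(0,T]$, such that $u(t)\in H_0^1(\Omega)$ for all $t\ge0$, and such that for every $t>0$ we have $F'(u(t))\in L^2(\Omega)$, $\mu(t)=-\varepsilon^2\Delta u(t)+F'(u(t))\in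 H^1_0(\Omega)$ and $\partial_t^\alpha u(t)=\gamma\Delta\mu(t)$ in the weak sense. It is bounded if $\sup_{t\ge0}\|u(t)\|<\infty$. A steady state is a time-independent $u_\infty\in H^1_0(\Omega)$ with $F'(u_\infty)\in L^2(\Omega)$, $\mu_\infty=-\varepsilon^2\Delta u_\infty+F'(u_\infty)\in H_0^1(\Omega)$ and $\Delta\mu_\infty=0$ weakly. For $t\ge0$ let $\Psi(t)\in H_0^1(\Omega)$ be the weak solution of $-\Delta\Psi(t)=u(t)-u(0)$, and define the modified energy $$\widetilde E(t)=E(t)+\frac{1}{\gamma\Gamma(1-\alpha)}D_{\Delta,\alpha}(t),\qquad D_{\Delta,\alpha}(t)=\frac{\|\nabla\Psi(t)\|^2}{2t^\alpha}+\frac\alpha2\int_0^t\frac{\|\nabla(\Psi(t)-\Psi(\tau))\|^2}{(t-\tau)^{\alpha+1}}\,d\tau\quad(t>0),$$ with $D_{\Delta,\alpha}(0)=0$. Let $\alpha\in(0,1)$ and let $u$ be a global bounded solution of the TFCH equation. Then: 1. The integral in $D_{\Delta,\alpha}(t)$ converges for every $t>0$, and $\widetilde E(0)=E(0)$; the value $D_{\Delta,\alpha}(0)=0$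 is the limit of $D_{\Delta,\alpha}(t)$ as $t\to0^+$, that is, $\widetilde E(t)-E(t)\to0$ as $t\to0^+$. 2. If $u(t)$ converges strongly in $L^2(\Omega)$, as $t\to\infty$, to a steady state $u_\infty$, and if there is $C>0$ with $\|u(t)-u(\tau)\|\le C|t-\tau|^\alpha$ for all $t,\tau\ge0$, then $\widetilde E(t)-E(t)\to0$ as $t\to+\infty$. Moreover: 3. Fix $u_0\in L^2(\Omega)$ and suppose that for every $\alpha<1$ sufficiently close to $1$ a global bounded solution $u_\alpha$ of the TFCH equation of order $\alpha$ with $u_\alpha(0)=u_0$ is given. Let $E_\alpha$ and $\widetilde E_\alpha$ be its energy and modified energy. Then for every fixed $t>0$, $\widetilde E_\alpha(t)-E_\alpha(t)\to0$ as $\alpha\to1^-$. -/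

import Mathlib

open Set Filter Topology MeasureTheory

namespace TFCH

noncomputable section

/-- The Euclidean space `ℝ^d`. -/
abbrev Space (d : ℕ) : Type := EuclideanSpace ℝ (Fin d)

/-- The real Hilbert space `L²(Ω)`. -/
abbrev L2 {d : ℕ} (Ω : Set (Space d)) : Type :=
  Lp ℝ 2 (volume.restrict Ω)

/-- The real Hilbert space `L²(Ω; ℝ^d)` of square-integrable vector fields. -/
abbrev L2vec {d : ℕ} (Ω : Set (Space d)) : Type :=
  Lp (Space d) 2 (volume.restrict Ω)

/-- `φ ∈ C_c^∞(Ω)`. -/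
structure IsTestFunction {d : ℕ} (Ω : Set (Space d)) (φ : Space d → ℝ) : Prop where
  contDiff : ContDiff ℝ (⊤ : ℕ∞) φ
  hasCompactSupport : HasCompactSupport φ
  tsupport_subset : tsupport φ ⊆ Ω

/-- The space `H₀¹(Ω)`, given as the set of all pairs `(v, ∇v)` with `v ∈ H₀¹(Ω)`:
the closure in `L²(Ω) × L²(Ω; ℝ^d)` of `{(φ, ∇φ) | φ ∈ C_c^∞(Ω)}`. -/
def H10 {d : ℕ} (Ω : Set (Space d)) : Set (L2 Ω × L2vec Ω) :=
  closure {p | ∃ φ : Space d → ℝ, IsTestFunction Ω φ ∧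
    p.1 =ᵐ[volume.restrict Ω] φ ∧ p.2 =ᵐ[volume.restrict Ω] gradient φ}

/-- `v ∈ H₀¹(Ω)`. -/
def MemH10 {d : ℕ} (Ω : Set (Space d)) (v : L2 Ω) : Prop :=
  ∃ G : L2vec Ω, (v, G) ∈ H10 Ω

/-- Integration by parts against a test function, on the whole of `H₀¹(Ω)`. -/
theorem integral_test_mul_grad {d : ℕ} {Ω : Set (Space d)} {φ : Space d → ℝ}
    (hφ : IsTestFunction Ω φ) (i : Fin d) {p : L2 Ω × L2vec Ω} (hp : p ∈ H10 Ω) :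
    ∫ x in Ω, φ x * p.2 x i =
      -∫ x in Ω, fderiv ℝ φ x (EuclideanSpace.single i 1) * p.1 x := by
  set e : Space d := EuclideanSpace.single i 1 with he
  have hd : ContDiff ℝ (⊤ : ℕ∞) (fun x => fderiv ℝ φ x e) :=
    (hφ.contDiff.fderiv_right (m := (⊤ : ℕ∞)) (by simp)).clm_apply contDiff_const
  have hdc : HasCompactSupport (fun x => fderiv ℝ φ x e) :=
    hφ.hasCompactSupport.fderiv_apply (𝕜 := ℝ) e
  have hc : MemLp (fun x => fderiv ℝ φ x e) 2 (volume.restrict Ω) :=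
    hd.continuous.memLp_of_hasCompactSupport hdc
  have hbc : HasCompactSupport (fun x => φ x • e) := hφ.hasCompactSupport.smul_right
  have hb : MemLp (fun x => φ x • e) 2 (volume.restrict Ω) :=
    (hφ.contDiff.continuous.smul continuous_const).memLp_of_hasCompactSupport hbc
  have key : ∀ q : L2 Ω × L2vec Ω,
      (inner ℝ (hb.toLp _) q.2 = ∫ x in Ω, φ x * q.2 x i) ∧
      (inner ℝ (hc.toLp _) q.1 = ∫ x in Ω, fderiv ℝ φ x e * q.1 x) := by
    intro q
    constructor
    · rw [L2.inner_def]
      refine integral_congr_ae ?_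
      filter_upwards [hb.coeFn_toLp] with x hx
      rw [hx, inner_smul_left, he, EuclideanSpace.inner_single_left]
      simp
    · rw [L2.inner_def]
      refine integral_congr_ae ?_
      filter_upwards [hc.coeFn_toLp] with x hx
      rw [hx]
      simp [mul_comm]
  have hcl : p ∈ {q : L2 Ω × L2vec Ω | inner ℝ (hb.toLp _) q.2 = -inner ℝ (hc.toLp _) q.1} := by
    refine closure_minimal ?_ (isClosed_eq (by fun_prop) (by fun_prop)) hp
    rintro q ⟨ψ, hψ, h1, h2⟩
    have hψd : Differentiable ℝ ψ := hψ.contDiff.differentiable (by simp)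
    have hφd : Differentiable ℝ φ := hφ.contDiff.differentiable (by simp)
    have hψe : ContDiff ℝ (⊤ : ℕ∞) (fun x => fderiv ℝ ψ x e) :=
      (hψ.contDiff.fderiv_right (m := (⊤ : ℕ∞)) (by simp)).clm_apply contDiff_const
    have ibp : ∫ x, φ x * fderiv ℝ ψ x e = -∫ x, fderiv ℝ φ x e * ψ x :=
      integral_mul_fderiv_eq_neg_fderiv_mul_of_integrable
        ((hd.continuous.mul hψ.contDiff.continuous).integrable_of_hasCompactSupport
          hdc.mul_right)
        ((hφ.contDiff.continuous.mul hψe.continuous).integrable_of_hasCompactSupport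
          hφ.hasCompactSupport.mul_right)
        ((hφ.contDiff.continuous.mul hψ.contDiff.continuous).integrable_of_hasCompactSupport
          hφ.hasCompactSupport.mul_right)
        (fun x _ => hφd x) (fun x _ => hψd x)
    have hz : ∀ x, x ∉ Ω → φ x = 0 := fun x hx =>
      image_eq_zero_of_notMem_tsupport fun h => hx (hφ.tsupport_subset h)
    have hz' : ∀ x, x ∉ Ω → ψ x = 0 := fun x hx =>
      image_eq_zero_of_notMem_tsupport fun h => hx (hψ.tsupport_subset h)
    have e1 : ∫ x in Ω, φ x * q.2 x i = ∫ x, φ x * fderiv ℝ ψ x e := by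
      rw [← setIntegral_eq_integral_of_forall_compl_eq_zero (s := Ω)
        (f := fun x => φ x * fderiv ℝ ψ x e) (fun x hx => by rw [hz x hx, zero_mul])]
      refine integral_congr_ae ?_
      filter_upwards [h2] with x hx
      have hg : inner ℝ (gradient ψ x) e = fderiv ℝ ψ x e :=
        (congrArg (fun L : Space d →L[ℝ] ℝ => L e)
          (hψd x).hasGradientAt.hasFDerivAt.fderiv).symm
      rw [hx, ← hg, he, EuclideanSpace.inner_single_right]
      simp
    have e2 : ∫ x in Ω, fderiv ℝ φ x e * q.1 x = ∫ x, fderiv ℝ φ x e * ψ x := by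
      rw [← setIntegral_eq_integral_of_forall_compl_eq_zero (s := Ω)
        (f := fun x => fderiv ℝ φ x e * ψ x) (fun x hx => by rw [hz' x hx, mul_zero])]
      refine integral_congr_ae ?_
      filter_upwards [h1] with x hx
      rw [hx]
    change inner ℝ (hb.toLp _) q.2 = -inner ℝ (hc.toLp _) q.1
    rw [(key q).1, (key q).2, e1, e2, ibp]
  have := hcl
  change inner ℝ (hb.toLp _) p.2 = -inner ℝ (hc.toLp _) p.1 at this
  rwa [(key p).1, (key p).2] at this

/-- The weak gradient is unique. -/
theorem H10_unique {d : ℕ} {Ω : Set (Space d)} (hΩ : IsOpen Ω) {v : L2 Ω} {G G' : L2vec Ω}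
    (h : (v, G) ∈ H10 Ω) (h' : (v, G') ∈ H10 Ω) : G = G' := by
  have main : ∀ i : Fin d, ∀ᵐ x ∂(volume.restrict Ω), x ∈ Ω → (G x - G' x) i = 0 := by
    intro i
    have hint : ∀ W : L2vec Ω, LocallyIntegrable (fun x => W x i) (volume.restrict Ω) := by
      intro W
      refine MemLp.locallyIntegrable (p := 2) ?_ (by norm_num)
      exact (EuclideanSpace.proj i : Space d →L[ℝ] ℝ).comp_memLp' (Lp.memLp W)
    have hG := hint G
    have hG' := hint G'
    refine hΩ.ae_eq_zero_of_integral_contDiff_smul_eq_zero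
      ((hG.sub hG').locallyIntegrableOn Ω) ?_
    intro φ h1 h2 h3
    have hφ : IsTestFunction Ω φ := ⟨h1, h2, h3⟩
    have a := integral_test_mul_grad hφ i h
    have b := integral_test_mul_grad hφ i h'
    have ia : Integrable (fun x => φ x * G x i) (volume.restrict Ω) :=
      hG.integrable_smul_left_of_hasCompactSupport h1.continuous h2
    have ib : Integrable (fun x => φ x * G' x i) (volume.restrict Ω) :=
      hG'.integrable_smul_left_of_hasCompactSupport h1.continuous h2
    have : ∀ x, φ x • (fun x => G x i - G' x i) x = φ x * G x i - φ x * G' x i := by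
      intro x; simp [mul_sub]
    calc _ = ∫ x in Ω, (φ x * G x i - φ x * G' x i) := integral_congr_ae (ae_of_all _ this)
      _ = 0 := by rw [integral_sub ia ib]; simp only at a b; rw [a, b, sub_self]
  refine Lp.ext ?_
  filter_upwards [ae_all_iff.2 main, ae_restrict_mem hΩ.measurableSet] with x hx hxΩ
  ext i
  have := hx i hxΩ
  simpa [sub_eq_zero] using this

open Classical in
/-- The weak gradient `∇v` of `v ∈ H₀¹(Ω)`. It is unique, see `grad_eq`; the value is `0` for
`v ∉ H₀¹(Ω)`. -/
def grad {d : ℕ} (Ω : Set (Space d)) (v : L2 Ω) : L2vec Ω :=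
  if h : ∃ G : L2vec Ω, (v, G) ∈ H10 Ω then h.choose else 0

theorem grad_eq {d : ℕ} {Ω : Set (Space d)} (hΩ : IsOpen Ω) {v : L2 Ω} {G : L2vec Ω}
    (h : (v, G) ∈ H10 Ω) : grad Ω v = G := by
  have hex : ∃ G : L2vec Ω, (v, G) ∈ H10 Ω := ⟨G, h⟩
  rw [grad, dif_pos hex]
  exact H10_unique hΩ hex.choose_spec h

/-- The Ginzburg--Landau energy `∫_Ω (ε²/2 |∇v|² + F(v)) dx` with `F(v) = (v² - 1)² / 4`. -/
def energy {d : ℕ} (Ω : Set (Space d)) (ε : ℝ) (v : L2 Ω) : ℝ :=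
  ε ^ 2 / 2 * ‖grad Ω v‖ ^ 2 + ∫ x in Ω, ((v x) ^ 2 - 1) ^ 2 / 4

/-- `μ = -ε² Δv + F'(v)` in the weak sense, for `v ∈ H₀¹(Ω)` with `F'(v) = v³ - v ∈ L²(Ω)`. -/
def IsChemicalPotential {d : ℕ} (Ω : Set (Space d)) (ε : ℝ) (v μ : L2 Ω) : Prop :=
  MemH10 Ω v ∧
  ∃ f : L2 Ω, (f =ᵐ[volume.restrict Ω] fun x => (v x) ^ 3 - v x) ∧
    ∀ φ : L2 Ω, MemH10 Ω φ →
      inner ℝ μ φ = ε ^ 2 * inner ℝ (grad Ω v) (grad Ω φ) + inner ℝ f φ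

/-- `g = γ Δ(-ε² Δv + F'(v))` in the weak sense with the homogeneous Dirichlet conditions
`v = 0` and `-ε² Δv + F'(v) = 0` on `∂Ω`. -/
def IsCahnHilliardRHS {d : ℕ} (Ω : Set (Space d)) (ε γ : ℝ) (v g : L2 Ω) : Prop :=
  ∃ μ : L2 Ω, IsChemicalPotential Ω ε v μ ∧ MemH10 Ω μ ∧
    ∀ φ : L2 Ω, MemH10 Ω φ → inner ℝ g φ = -γ * inner ℝ (grad Ω μ) (grad Ω φ)

/-- A steady state of the Cahn--Hilliard equation: `0 = γ Δ(-ε² Δv + F'(v))`. -/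
def IsSteadyState {d : ℕ} (Ω : Set (Space d)) (ε γ : ℝ) (v : L2 Ω) : Prop :=
  IsCahnHilliardRHS Ω ε γ v 0

/-- The Caputo derivative
`∂_t^α u (t) = Γ(1-α)⁻¹ ∫_0^t (t-τ)^{-α} ∂_τ u(τ) dτ`, a Bochner integral in `L²(Ω)`. -/
def caputo {d : ℕ} {Ω : Set (Space d)} (α : ℝ) (u : ℝ → L2 Ω) (t : ℝ) : L2 Ω :=
  (Real.Gamma (1 - α))⁻¹ • ∫ τ in (0 : ℝ)..t, (t - τ) ^ (-α) • deriv u τ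

/-- `u` is a global solution of the time-fractional Cahn--Hilliard equation
`∂_t^α u = γ Δ(-ε² Δu + F'(u))` on `Ω × (0, ∞)` with homogeneous Dirichlet boundary condition, in
the usual regularity class of time-fractional phase-field equations:
`u ∈ C([0,∞); L²) ∩ C¹((0,∞); L²)` with `‖∂_t u(t)‖ ≤ C_T t^{α-1}` on every `(0, T]`. Only the
values of `u` on `[0, ∞)` matter. -/
structure IsGlobalSolution {d : ℕ} (Ω : Set (Space d)) (ε γ α : ℝ) (u : ℝ → L2 Ω) : Prop where
  continuousOn : ContinuousOn u (Ici 0)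
  differentiableAt : ∀ t, 0 < t → DifferentiableAt ℝ u t
  continuousOn_deriv : ContinuousOn (deriv u) (Ioi 0)
  deriv_bound : ∀ T, 0 < T → ∃ C, ∀ t, 0 < t → t ≤ T → ‖deriv u t‖ ≤ C * t ^ (α - 1)
  memH10 : ∀ t, 0 ≤ t → MemH10 Ω (u t)
  equation : ∀ t, 0 < t → IsCahnHilliardRHS Ω ε γ (u t) (caputo α u t)

/-- A global solution that is bounded in `L²(Ω)` uniformly in time. -/
def IsGlobalBoundedSolution {d : ℕ} (Ω : Set (Space d)) (ε γ α : ℝ) (u : ℝ → L2 Ω) : Prop :=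
  IsGlobalSolution Ω ε γ α u ∧ ∃ M, ∀ t, 0 ≤ t → ‖u t‖ ≤ M

/-- `ψ ∈ H₀¹(Ω)` is the weak solution of `-Δψ = f` with homogeneous Dirichlet boundary
condition. -/
def IsPoissonSolution {d : ℕ} (Ω : Set (Space d)) (f ψ : L2 Ω) : Prop :=
  MemH10 Ω ψ ∧ ∀ φ : L2 Ω, MemH10 Ω φ → inner ℝ (grad Ω ψ) (grad Ω φ) = inner ℝ f φ

/-- `Ψ(t)` solves `-ΔΨ(t) = u(t) - u(0)` with homogeneous Dirichlet boundary condition, for all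
`t ≥ 0`. -/
def IsPotential {d : ℕ} (Ω : Set (Space d)) (u Ψ : ℝ → L2 Ω) : Prop :=
  ∀ t, 0 ≤ t → IsPoissonSolution Ω (u t - u 0) (Ψ t)

/-- The integrand `‖∇(Ψ(t) - Ψ(τ))‖² / (t - τ)^{α+1}` of the memory term. -/
def memoryIntegrand {d : ℕ} (Ω : Set (Space d)) (α : ℝ) (Ψ : ℝ → L2 Ω) (t τ : ℝ) : ℝ :=
  ‖grad Ω (Ψ t - Ψ τ)‖ ^ 2 / (t - τ) ^ (α + 1)

/-- `D_{Δ,α}(t) = ‖∇Ψ(t)‖² / (2 t^α) + (α/2) ∫_0^t ‖∇(Ψ(t)-Ψ(τ))‖² / (t-τ)^{α+1} dτ`.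
At `t = 0` the first term reads `0 / 0`, which is `0` here. -/
def memoryTerm {d : ℕ} (Ω : Set (Space d)) (α : ℝ) (Ψ : ℝ → L2 Ω) (t : ℝ) : ℝ :=
  ‖grad Ω (Ψ t)‖ ^ 2 / (2 * t ^ α) + α / 2 * ∫ τ in (0 : ℝ)..t, memoryIntegrand Ω α Ψ t τ

/-- The modified energy `Ẽ(t) = E(t) + D_{Δ,α}(t) / (γ Γ(1-α))`. -/
def modifiedEnergy {d : ℕ} (Ω : Set (Space d)) (ε γ α : ℝ) (u Ψ : ℝ → L2 Ω) (t : ℝ) : ℝ :=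
  energy Ω ε (u t) + 1 / (γ * Real.Gamma (1 - α)) * memoryTerm Ω α Ψ t

end

end TFCH

/-! Let `A f = ∇ψ` for the weak solution `ψ ∈ H₀¹(Ω)` of `-Δψ = f`. The memory term depends on `u`
only through `‖A (u t - u τ)‖`. If this is at most `H (t - τ)^α` for `0 ≤ τ ≤ t`, then the memory
integrand is at most `H² (t - τ)^(α-1)` and the memory term at `t` at most `H² t^α`
(`IsPotential.memoryTerm_le`). Integrating `‖∂ₜu‖ ≤ C_T t^(α-1)` gives such an `H` on each `[0, T]`,
hence convergence of the integral and the limit at `0`. For `t → ∞`, the substitution `τ = t - s`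
and dominated convergence suffice (`tendsto_integral_holder`): the Hölder bound dominates for `s ≤
1`, boundedness of `u` for `s > 1`, and `u t - u (t - s) → 0` for each fixed `s`.

As `α → 1` the factor `1 / Γ(1-α)` tends to `0`, so it is enough to bound the memory term at `t`
uniformly in `α`. The constants `C_T` may depend on `α` without control, so this bound has to come
from the equation. The function `V t = A (u t - u 0)` is a fractional gradient flow of an energy `E`
for which `E + κ‖·‖²` is convex, `κ = 1 / (8ε²)` (`IsGlobalSolution.isFractionalFlow`). The Caputo
derivative is an integral of `V t - V τ` against a positive measure, so convexity inequalities can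
be integrated.

The uniform Lipschitz estimate compares the flow with its time dilation `V (l t)`, whose Caputo
derivative is `l^α` times that of `V` at `l t`. The mismatch `(l^α - 1) w (l t)` is absorbed by the
energy dissipation `-‖w‖²/γ`, and a Gronwall inequality with constants independent of `α ∈ [1/2, 1)`
(`caputo_gronwall`) gives `‖V (l t) - V t‖ ≤ const · (l - 1)` (`IsFractionalFlow.dilation_sq_le`).
The choice `l = t / τ` makes this a Lipschitz bound at `t` (`exists_lipschitz_fractionalFlow`). -/

namespace TFCH

/-! ### The Caputo derivative as integration against a positive measure. -/

noncomputable section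

variable {E : Type*} [NormedAddCommGroup E]

/-- The measure `t^{-α} δ₀ + α (t - τ)^{-α-1} dτ` on `[0, t]`. The Caputo derivative of `f` at `t` is
`Γ(1-α)⁻¹ ∫ (f t - f τ) dm`. -/
def caputoMeasure (α t : ℝ) : Measure ℝ :=
  ENNReal.ofReal (t ^ (-α)) • Measure.dirac 0 +
    (volume.restrict (Ioc 0 t)).withDensity
      (fun τ => ((Real.toNNReal (α * (t - τ) ^ (-α - 1)) : NNReal) : ENNReal))

theorem measurable_caputoKernel (α t : ℝ) :
    Measurable (fun τ : ℝ => Real.toNNReal (α * (t - τ) ^ (-α - 1))) := by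
  fun_prop

theorem ae_caputoMeasure_mem_Icc {α t : ℝ} (ht : 0 < t) :
    ∀ᵐ τ ∂caputoMeasure α t, τ ∈ Icc 0 t := by
  rw [caputoMeasure, ae_add_measure_iff]
  constructor
  · refine Measure.ae_smul_measure ?_ _
    exact (ae_dirac_iff (p := fun τ => τ ∈ Icc 0 t) measurableSet_Icc).2 ⟨le_rfl, ht.le⟩
  · refine (withDensity_absolutelyContinuous _ _).ae_le ?_
    filter_upwards [ae_restrict_mem measurableSet_Ioc] with τ hτ
    exact ⟨hτ.1.le, hτ.2⟩

theorem caputoKernel_smul_eqOn [NormedSpace ℝ E] {α t : ℝ} (hα : 0 < α) (g : ℝ → E) :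
    EqOn (fun τ => Real.toNNReal (α * (t - τ) ^ (-α - 1)) • g τ)
      (fun τ => α • ((t - τ) ^ (-α - 1) • g τ)) (Ioc 0 t) := by
  intro τ hτ
  have h : 0 ≤ α * (t - τ) ^ (-α - 1) :=
    mul_nonneg hα.le (Real.rpow_nonneg (sub_nonneg.2 hτ.2) _)
  simp only [NNReal.smul_def, Real.coe_toNNReal _ h, mul_smul]

theorem integrable_caputoMeasure [NormedSpace ℝ E] {α t : ℝ} (hα : 0 < α) (ht : 0 < t) {g : ℝ → E}
    (hg : IntervalIntegrable (fun τ => (t - τ) ^ (-α - 1) • g τ) volume 0 t) :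
    Integrable g (caputoMeasure α t) := by
  rw [caputoMeasure]
  refine Integrable.add_measure ?_ ?_
  · exact (integrable_dirac (by simp)).smul_measure (by simp)
  · rw [integrable_withDensity_iff_integrable_smul (measurable_caputoKernel α t)]
    rw [intervalIntegrable_iff_integrableOn_Ioc_of_le ht.le] at hg
    exact IntegrableOn.congr_fun (hg.smul α) (caputoKernel_smul_eqOn hα g).symm measurableSet_Ioc

theorem intervalIntegrable_of_integrable_caputoMeasure [NormedSpace ℝ E] {α t : ℝ} (hα : 0 < α)
    (ht : 0 < t) {g : ℝ → E} (hg : Integrable g (caputoMeasure α t)) :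
    IntervalIntegrable (fun τ => (t - τ) ^ (-α - 1) • g τ) volume 0 t := by
  have h := hg.right_of_add_measure
  rw [integrable_withDensity_iff_integrable_smul (measurable_caputoKernel α t)] at h
  rw [intervalIntegrable_iff_integrableOn_Ioc_of_le ht.le]
  have h2 := (IntegrableOn.congr_fun h (caputoKernel_smul_eqOn hα g) measurableSet_Ioc).smul α⁻¹
  refine IntegrableOn.congr_fun h2 (fun τ _ => ?_) measurableSet_Ioc
  simp [smul_smul, inv_mul_cancel_left₀ hα.ne']

theorem integral_caputoMeasure [NormedSpace ℝ E] [CompleteSpace E] {α t : ℝ} (hα : 0 < α)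
    (ht : 0 < t) {g : ℝ → E}
    (hg : Integrable g (caputoMeasure α t)) :
    ∫ τ, g τ ∂caputoMeasure α t =
      t ^ (-α) • g 0 + α • ∫ τ in (0 : ℝ)..t, (t - τ) ^ (-α - 1) • g τ := by
  rw [caputoMeasure, integral_add_measure hg.left_of_add_measure hg.right_of_add_measure,
    integral_smul_measure, integral_dirac,
    integral_withDensity_eq_integral_smul (measurable_caputoKernel α t),
    ENNReal.toReal_ofReal (Real.rpow_nonneg ht.le _), intervalIntegral.integral_of_le ht.le,
    ← integral_smul, setIntegral_congr_fun measurableSet_Ioc (caputoKernel_smul_eqOn hα g)]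

theorem intervalIntegrable_sub_rpow {t r : ℝ} (hr : -1 < r) (s : ℝ) :
    IntervalIntegrable (fun τ : ℝ => (t - τ) ^ r) volume s t := by
  have h := (intervalIntegral.intervalIntegrable_rpow' (a := t - s) (b := 0) hr).comp_sub_left t
  simpa using h

theorem integral_sub_rpow {t r : ℝ} (hr : -1 < r) (s : ℝ) :
    ∫ τ in s..t, (t - τ) ^ r = (t - s) ^ (r + 1) / (r + 1) := by
  rw [intervalIntegral.integral_comp_sub_left (fun x => x ^ r) t, integral_rpow (Or.inl hr)]
  simp [Real.zero_rpow (by linarith : r + 1 ≠ 0)]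

/-- The class of functions whose Caputo derivative converges at every positive time. -/
structure CaputoAdmissible (f : ℝ → E) : Prop where
  continuousOn : ContinuousOn f (Ioi 0)
  lipschitzAt : ∀ t, 0 < t → ∃ K, ∀ τ, 0 ≤ τ → τ ≤ t → ‖f t - f τ‖ ≤ K * (t - τ)

theorem intervalIntegrable_kernel_smul [NormedSpace ℝ E] {α t K : ℝ} (hα1 : α < 1) (ht : 0 < t)
    {g : ℝ → E} (hg : ContinuousOn g (Ioc 0 t)) (hK : ∀ τ, 0 < τ → τ ≤ t → ‖g τ‖ ≤ K * (t - τ)) :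
    IntervalIntegrable (fun τ => (t - τ) ^ (-α - 1) • g τ) volume 0 t := by
  have h := (intervalIntegrable_sub_rpow (t := t) (r := -α) (by linarith) 0).const_mul K
  rw [intervalIntegrable_iff_integrableOn_Ioc_of_le ht.le] at h ⊢
  refine Integrable.mono' h ?_ ?_
  · refine AEStronglyMeasurable.smul ?_ (hg.aestronglyMeasurable measurableSet_Ioc)
    exact (by fun_prop : Measurable fun τ : ℝ => (t - τ) ^ (-α - 1)).aestronglyMeasurable
  · filter_upwards [ae_restrict_mem measurableSet_Ioc] with τ hτ
    have h0 : 0 ≤ t - τ := sub_nonneg.2 hτ.2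
    rw [norm_smul, Real.norm_of_nonneg (Real.rpow_nonneg h0 _)]
    rcases h0.eq_or_lt with h0 | h0
    · have : ‖g τ‖ = 0 := by
        have := hK τ hτ.1 hτ.2
        rw [← h0, mul_zero] at this
        exact le_antisymm this (norm_nonneg _)
      rw [this, mul_zero, ← h0]
      -- As `0 ^ 0 = 1`, the majorant at `τ = t` equals `K` when `α = 0`, and the sign of `K` is
      -- needed.
      by_cases hα : α = 0
      · subst hα
        have := hK τ hτ.1 hτ.2
        have hK0 : 0 ≤ K := by
          have := (norm_nonneg _).trans (hK (t / 2) (by linarith) (by linarith))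
          nlinarith
        simpa using hK0
      · rw [Real.zero_rpow (by simpa using hα), mul_zero]
    · calc (t - τ) ^ (-α - 1) * ‖g τ‖ ≤ (t - τ) ^ (-α - 1) * (K * (t - τ)) :=
            mul_le_mul_of_nonneg_left (hK τ hτ.1 hτ.2) (Real.rpow_nonneg h0.le _)
        _ = K * (t - τ) ^ (-α) := by
            rw [show -α = (-α - 1) + 1 by ring, Real.rpow_add_one h0.ne' (-α - 1)]
            ring_nf

theorem CaputoAdmissible.integrable [NormedSpace ℝ E] {α t : ℝ} {f : ℝ → E} (hf : CaputoAdmissible f)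
    (hα : 0 < α) (hα1 : α < 1) (ht : 0 < t) : Integrable (fun τ => f t - f τ) (caputoMeasure α t) := by
  obtain ⟨K, hK⟩ := hf.lipschitzAt t ht
  exact integrable_caputoMeasure hα ht (intervalIntegrable_kernel_smul hα1 ht
    (continuousOn_const.sub (hf.continuousOn.mono fun τ h => h.1)) fun τ h h' => hK τ h.le h')

theorem CaputoAdmissible.comp_mul {f : ℝ → E} (hf : CaputoAdmissible f) {l : ℝ} (hl : 0 < l) :
    CaputoAdmissible (fun t => f (l * t)) := by
  refine ⟨hf.continuousOn.comp (by fun_prop) fun t ht => mul_pos hl ht, fun t ht => ?_⟩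
  obtain ⟨K, hK⟩ := hf.lipschitzAt (l * t) (mul_pos hl ht)
  refine ⟨K * l, fun τ h h' => ?_⟩
  have := hK (l * τ) (by positivity) (mul_le_mul_of_nonneg_left h' hl.le)
  linarith [this]

theorem CaputoAdmissible.sub {f g : ℝ → E} (hf : CaputoAdmissible f) (hg : CaputoAdmissible g) :
    CaputoAdmissible (fun t => f t - g t) := by
  refine ⟨hf.continuousOn.sub hg.continuousOn, fun t ht => ?_⟩
  obtain ⟨K, hK⟩ := hf.lipschitzAt t ht
  obtain ⟨K', hK'⟩ := hg.lipschitzAt t ht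
  refine ⟨K + K', fun τ h h' => ?_⟩
  have e : f t - g t - (f τ - g τ) = (f t - f τ) - (g t - g τ) := by abel
  rw [e]
  linarith [norm_sub_le (f t - f τ) (g t - g τ), hK τ h h', hK' τ h h']

theorem CaputoAdmissible.add {f g : ℝ → E} (hf : CaputoAdmissible f) (hg : CaputoAdmissible g) :
    CaputoAdmissible (fun t => f t + g t) := by
  refine ⟨hf.continuousOn.add hg.continuousOn, fun t ht => ?_⟩
  obtain ⟨K, hK⟩ := hf.lipschitzAt t ht
  obtain ⟨K', hK'⟩ := hg.lipschitzAt t ht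
  refine ⟨K + K', fun τ h h' => ?_⟩
  have e : f t + g t - (f τ + g τ) = (f t - f τ) + (g t - g τ) := by abel
  rw [e]
  linarith [norm_add_le (f t - f τ) (g t - g τ), hK τ h h', hK' τ h h']

theorem CaputoAdmissible.add_const {f : ℝ → E} (hf : CaputoAdmissible f) (c : E) :
    CaputoAdmissible (fun t => f t + c) := by
  refine ⟨hf.continuousOn.add continuousOn_const, fun t ht => ?_⟩
  simpa using hf.lipschitzAt t ht

theorem CaputoAdmissible.const_mul {f : ℝ → ℝ} (hf : CaputoAdmissible f) {c : ℝ} (hc : 0 ≤ c) :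
    CaputoAdmissible (fun t => c * f t) := by
  refine ⟨continuousOn_const.mul hf.continuousOn, fun t ht => ?_⟩
  obtain ⟨K, hK⟩ := hf.lipschitzAt t ht
  refine ⟨c * K, fun τ h h' => ?_⟩
  rw [← mul_sub, norm_mul, Real.norm_of_nonneg hc, mul_assoc]
  exact mul_le_mul_of_nonneg_left (hK τ h h') hc

theorem CaputoAdmissible.norm_sq {f : ℝ → E} (hf : CaputoAdmissible f) :
    CaputoAdmissible (fun t => ‖f t‖ ^ 2) := by
  refine ⟨hf.continuousOn.norm.pow 2, fun t ht => ?_⟩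
  obtain ⟨K, hK⟩ := hf.lipschitzAt t ht
  have hK0 : 0 ≤ K * t := by simpa using (norm_nonneg _).trans (hK 0 le_rfl ht.le)
  refine ⟨K * (2 * ‖f t‖ + K * t), fun τ h h' => ?_⟩
  have h1 := hK τ h h'
  have h2 : |‖f t‖ - ‖f τ‖| ≤ K * (t - τ) := (abs_norm_sub_norm_le _ _).trans h1
  have hK1 : 0 ≤ K := by
    by_contra hneg
    push Not at hneg
    nlinarith
  have h3 : K * (t - τ) ≤ K * t := by nlinarith
  have h4 : ‖f t‖ + ‖f τ‖ ≤ 2 * ‖f t‖ + K * t := by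
    linarith [(abs_le.1 h2).1]
  rw [Real.norm_eq_abs, show ‖f t‖ ^ 2 - ‖f τ‖ ^ 2 = (‖f t‖ - ‖f τ‖) * (‖f t‖ + ‖f τ‖) by ring,
    abs_mul, abs_of_nonneg (add_nonneg (norm_nonneg (f t)) (norm_nonneg (f τ)))]
  calc _ ≤ (K * (t - τ)) * (2 * ‖f t‖ + K * t) :=
        mul_le_mul h2 h4 (by positivity) ((abs_nonneg _).trans h2)
    _ = _ := by ring

/-- Scaling of the Caputo derivative. -/
theorem integral_caputoMeasure_comp_mul [NormedSpace ℝ E] [CompleteSpace E] {α t l : ℝ} {f : ℝ → E}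
    (hf : CaputoAdmissible f) (hα : 0 < α) (hα1 : α < 1) (ht : 0 < t) (hl : 0 < l) :
    ∫ τ, (f (l * t) - f (l * τ)) ∂caputoMeasure α t =
      l ^ α • ∫ τ, (f (l * t) - f τ) ∂caputoMeasure α (l * t) := by
  rw [integral_caputoMeasure hα ht ((hf.comp_mul hl).integrable hα hα1 ht),
    integral_caputoMeasure hα (mul_pos hl ht) (hf.integrable hα hα1 (mul_pos hl ht))]
  have hl' : l ^ α * l ^ (-α) = 1 := by rw [← Real.rpow_add hl]; simp
  -- Substituting `τ ↦ l τ`: the kernel contributes `l^(-α-1)` and `dτ` contributes `l`.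
  have e : ∫ τ in (0 : ℝ)..t, (t - τ) ^ (-α - 1) • (f (l * t) - f (l * τ)) =
      l ^ α • ∫ τ in (0 : ℝ)..(l * t), (l * t - τ) ^ (-α - 1) • (f (l * t) - f τ) := by
    have h := intervalIntegral.integral_comp_mul_left (a := 0) (b := t)
      (fun τ => (l * t - τ) ^ (-α - 1) • (f (l * t) - f τ)) hl.ne'
    rw [mul_zero] at h
    rw [show (∫ τ in (0 : ℝ)..(l * t), (l * t - τ) ^ (-α - 1) • (f (l * t) - f τ)) =
      l • ∫ x in (0 : ℝ)..t, (l * t - l * x) ^ (-α - 1) • (f (l * t) - f (l * x)) by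
        rw [h, smul_smul, mul_inv_cancel₀ hl.ne', one_smul], smul_smul,
      ← intervalIntegral.integral_smul]
    refine intervalIntegral.integral_congr fun τ hτ => ?_
    rw [uIcc_of_le ht.le] at hτ
    simp only [smul_smul]
    congr 1
    rw [← mul_sub, Real.mul_rpow hl.le (sub_nonneg.2 hτ.2), ← Real.rpow_add_one hl.ne', ← mul_assoc,
      ← Real.rpow_add hl]
    simp
  rw [e, smul_add, smul_smul, smul_smul, smul_smul, Real.mul_rpow hl.le ht.le, ← mul_assoc, hl',
    one_mul, mul_zero, mul_comm α]

end

end TFCH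

/-! ### A fractional Gronwall inequality uniform in the order. -/

namespace TFCH

noncomputable section

/-- `Γ` is convex with `Γ(1) = Γ(2) = 1`, so `(1 - α) Γ(1 - α) = Γ(2 - α) ≤ 1`. -/
theorem Gamma_one_sub_le {α : ℝ} (hα : 0 ≤ α) (hα1 : α < 1) :
    Real.Gamma (1 - α) ≤ 1 / (1 - α) := by
  have h0 : 0 < 1 - α := by linarith
  have h1 : Real.Gamma (1 - α + 1) = (1 - α) * Real.Gamma (1 - α) := Real.Gamma_add_one h0.ne'
  have h2 := Real.convexOn_Gamma.2 (show (1 : ℝ) ∈ Ioi 0 by simp) (show (2 : ℝ) ∈ Ioi 0 by simp)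
    hα h0.le (by ring)
  rw [smul_eq_mul, smul_eq_mul, Real.Gamma_one, Real.Gamma_two, smul_eq_mul, smul_eq_mul] at h2
  rw [show α * 1 + (1 - α) * 2 = 1 - α + 1 by ring, h1] at h2
  rw [le_div_iff₀ h0]
  linarith

theorem tendsto_inv_Gamma_one_sub :
    Tendsto (fun α : ℝ => (Real.Gamma (1 - α))⁻¹) (𝓝[<] 1) (𝓝 0) := by
  have hc : ContinuousAt Real.Gamma 1 :=
    (Real.differentiableAt_Gamma fun m h => by
      have : (0 : ℝ) ≤ m := m.cast_nonneg
      linarith).continuousAt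
  have h1 : Tendsto (fun α : ℝ => 1 - α + 1) (𝓝[<] 1) (𝓝 1) := by
    have : Tendsto (fun α : ℝ => 1 - α + 1) (𝓝 1) (𝓝 (1 - 1 + 1)) :=
      Continuous.tendsto (by fun_prop) 1
    simpa using this.mono_left nhdsWithin_le_nhds
  have h2 : Tendsto (fun α : ℝ => 1 - α) (𝓝[<] 1) (𝓝 0) := by
    have : Tendsto (fun α : ℝ => 1 - α) (𝓝 1) (𝓝 (1 - 1)) := Continuous.tendsto (by fun_prop) 1
    simpa using this.mono_left nhdsWithin_le_nhds
  have h3 := h2.mul ((hc.tendsto.comp h1).inv₀ (by simp))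
  rw [zero_mul] at h3
  refine h3.congr' ?_
  filter_upwards [self_mem_nhdsWithin] with α hα
  have h0 : 1 - α ≠ 0 := (sub_pos.2 hα).ne'
  simp only [Function.comp_apply]
  rw [Real.Gamma_add_one h0, mul_inv, ← mul_assoc, mul_inv_cancel₀ h0, one_mul]

theorem half_le_one_sub_exp_neg {x : ℝ} (h0 : 0 ≤ x) (h1 : x ≤ 1) :
    x / 2 ≤ 1 - Real.exp (-x) := by
  have h : Real.exp (-x) * (1 + x) ≤ 1 := by
    have := mul_le_mul_of_nonneg_left (Real.add_one_le_exp x) (Real.exp_pos (-x)).le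
    rw [← Real.exp_add] at this
    simpa [add_comm] using this
  nlinarith [Real.exp_pos (-x), mul_nonneg h0 (sub_nonneg.2 h1)]

/-- A lower bound for the Caputo derivative of `e^{Bt}`, up to constants. -/
theorem rpow_le_kernel_sum {α B t : ℝ} (hα : 1 / 2 ≤ α) (hα1 : α < 1) (hB : 0 < B) (ht : 0 < t) :
    B ^ α / 2 ≤ (1 - α) * t ^ (-α) + α * (B * (min t (1 / B)) ^ (1 - α)) := by
  have hBα : 0 < B ^ α := Real.rpow_pos_of_pos hB _
  rcases le_total t (1 / B) with h | h
  · rw [min_eq_left h]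
    have hy : 0 ≤ B * t ^ (1 - α) := by positivity
    -- In the weighted geometric mean the powers of `t` cancel and `B^α` remains.
    have := Real.geom_mean_le_arith_mean2_weighted (w₁ := 1 - α) (w₂ := α) (p₁ := t ^ (-α))
      (p₂ := B * t ^ (1 - α)) (by linarith) (by linarith) (by positivity) hy (by ring)
    rw [Real.mul_rpow hB.le (by positivity), ← Real.rpow_mul ht.le, ← Real.rpow_mul ht.le,
      mul_left_comm, ← Real.rpow_add ht,
      show -α * (1 - α) + (1 - α) * α = 0 by ring, Real.rpow_zero, mul_one] at this
    linarith
  · rw [min_eq_right h]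
    have e : B * (1 / B) ^ (1 - α) = B ^ α := by
      rw [one_div, Real.inv_rpow hB.le, ← Real.rpow_neg hB.le, ← Real.rpow_one_add' hB.le]
      · congr 1; ring
      · intro h; linarith
    rw [e]
    have : 0 ≤ (1 - α) * t ^ (-α) := mul_nonneg (by linarith) (by positivity)
    nlinarith

/-- A Gronwall inequality for the Caputo derivative, with constants that are uniform in
`α ∈ [1/2, 1)`. -/
theorem caputo_gronwall {α A B T : ℝ} (hα : 1 / 2 ≤ α) (hα1 : α < 1) (hA : 0 ≤ A)
    (hB1 : 1 ≤ B) (hB : (4 * A) ^ 2 < B) {p : ℝ → ℝ} (hp : CaputoAdmissible p) (hp0 : 0 < p 0)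
    (hev : ∀ᶠ t in 𝓝[>] (0 : ℝ), p t ≤ 2 * p 0)
    (h : ∀ t, 0 < t → t ≤ T →
      ∫ τ, (p t - p τ) ∂caputoMeasure α t ≤ A * Real.Gamma (1 - α) * p t) :
    ∀ t, 0 < t → t ≤ T → p t ≤ 2 * p 0 * Real.exp (B * t) := by
  by_contra! hcon
  obtain ⟨t₀, ht₀, ht₀T, hlt⟩ := hcon
  have hα0 : 0 < α := by linarith
  have hB0 : 0 < B := by linarith
  obtain ⟨δ, hδ, hδp⟩ := mem_nhdsGT_iff_exists_Ioo_subset.1 hev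
  have hδ0 : 0 < δ := hδ
  have hδt : δ ≤ t₀ := by
    by_contra! hh
    have h1 : p t₀ ≤ 2 * p 0 := hδp ⟨ht₀, hh⟩
    have h2 : 1 ≤ Real.exp (B * t₀) := Real.one_le_exp (by positivity)
    nlinarith
  -- Continuity at `0` is not available, so the maximum of `p t * exp (-(B t))` is taken over `[δ,
  -- T]`. It exceeds `2 * p 0`, which bounds `p` on `(0, δ)`; hence `p ≤ M exp (B ·)` on all of `(0,
  -- T]`.
  obtain ⟨s, hs, hmax⟩ := isCompact_Icc.exists_isMaxOn (s := Icc δ T)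
    (f := fun t => p t * Real.exp (-(B * t))) ⟨t₀, hδt, ht₀T⟩
    ((hp.continuousOn.mono fun x hx => lt_of_lt_of_le hδ0 hx.1).mul (by fun_prop))
  set M := p s * Real.exp (-(B * s)) with hMdef
  have hs0 : 0 < s := lt_of_lt_of_le hδ0 hs.1
  have expc : ∀ x, Real.exp (-(B * x)) * Real.exp (B * x) = 1 := fun x => by
    rw [← Real.exp_add]; simp
  have hM : 2 * p 0 < M := by
    have h1 : p t₀ * Real.exp (-(B * t₀)) ≤ M := hmax ⟨hδt, ht₀T⟩
    have h2 := mul_lt_mul_of_pos_right hlt (Real.exp_pos (-(B * t₀)))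
    rw [mul_assoc, mul_comm (Real.exp (B * t₀)), expc, mul_one] at h2
    linarith
  have hM0 : 0 < M := by linarith
  have hps : p s = M * Real.exp (B * s) := by rw [hMdef, mul_assoc, expc, mul_one]
  have hle : ∀ τ, 0 < τ → τ ≤ T → p τ ≤ M * Real.exp (B * τ) := by
    intro τ h0 hT
    rcases lt_or_ge τ δ with h1 | h1
    · have h2 : p τ ≤ 2 * p 0 := hδp ⟨h0, h1⟩
      have h3 : 1 ≤ Real.exp (B * τ) := Real.one_le_exp (by positivity)
      nlinarith
    · have h2 : p τ * Real.exp (-(B * τ)) ≤ M := hmax ⟨h1, hT⟩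
      have h3 := mul_le_mul_of_nonneg_right h2 (Real.exp_pos (B * τ)).le
      rwa [mul_assoc, expc, mul_one] at h3
  set X := M * Real.exp (B * s) with hX
  have hX0 : 0 < X := by positivity
  have hdiff : ∀ τ, 0 < τ → τ ≤ s → X * (1 - Real.exp (-(B * (s - τ)))) ≤ p s - p τ := by
    intro τ h0 h1
    have h2 := hle τ h0 (h1.trans hs.2)
    have h3 : X * Real.exp (-(B * (s - τ))) = M * Real.exp (B * τ) := by
      rw [hX, mul_assoc, ← Real.exp_add]; congr 2; ring
    rw [mul_sub, h3, hps]
    linarith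
  -- Only the last stretch of length `r` is kept: there `B (s - τ) ≤ 1`, so `1 - exp (-x) ≥ x / 2`
  -- applies. The rest of the integral is nonnegative.
  set r := min s (1 / B) with hr
  have hr0 : 0 < r := lt_min hs0 (by positivity)
  have hrs : r ≤ s := min_le_left _ _
  have hrB : B * r ≤ 1 := by
    have := mul_le_mul_of_nonneg_left (min_le_right s (1 / B)) hB0.le
    rwa [mul_one_div_cancel hB0.ne'] at this
  have hint := hp.integrable hα0 hα1 hs0
  have hii := intervalIntegrable_of_integrable_caputoMeasure hα0 hs0 hint
  have hi1 : IntervalIntegrable (fun τ => (s - τ) ^ (-α - 1) • (p s - p τ)) volume 0 (s - r) :=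
    hii.mono_set (by
      rw [uIcc_of_le hs0.le, uIcc_of_le (by linarith)]; exact Icc_subset_Icc_right (by linarith))
  have hi2 : IntervalIntegrable (fun τ => (s - τ) ^ (-α - 1) • (p s - p τ)) volume (s - r) s :=
    hii.mono_set (by
      rw [uIcc_of_le hs0.le, uIcc_of_le (by linarith)]; exact Icc_subset_Icc_left (by linarith))
  have hI : X * B / 2 * (r ^ (1 - α) / (1 - α)) ≤
      ∫ τ in (0 : ℝ)..s, (s - τ) ^ (-α - 1) • (p s - p τ) := by
    rw [← intervalIntegral.integral_add_adjacent_intervals hi1 hi2]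
    have h1 : 0 ≤ ∫ τ in (0 : ℝ)..(s - r), (s - τ) ^ (-α - 1) • (p s - p τ) := by
      rw [intervalIntegral.integral_of_le (by linarith)]
      refine setIntegral_nonneg measurableSet_Ioc fun τ hτ => ?_
      have hτs : 0 ≤ s - τ := by linarith [hτ.2]
      refine mul_nonneg (Real.rpow_nonneg hτs _) ?_
      refine le_trans (mul_nonneg hX0.le ?_) (hdiff τ hτ.1 (by linarith))
      rw [sub_nonneg, Real.exp_le_one_iff]
      have := mul_nonneg hB0.le hτs
      linarith
    have h2 : X * B / 2 * (r ^ (1 - α) / (1 - α)) ≤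
        ∫ τ in (s - r)..s, (s - τ) ^ (-α - 1) • (p s - p τ) := by
      have e : X * B / 2 * (r ^ (1 - α) / (1 - α)) =
          ∫ τ in (s - r)..s, X * B / 2 * (s - τ) ^ (-α) := by
        rw [intervalIntegral.integral_const_mul, integral_sub_rpow (by linarith)]
        rw [sub_sub_cancel, neg_add_eq_sub]
      rw [e]
      refine intervalIntegral.integral_mono_on_of_le_Ioo (by linarith)
        ((intervalIntegrable_sub_rpow (by linarith) _).const_mul _) hi2 fun τ hτ => ?_
      have hτ0 : 0 < τ := by linarith [hτ.1]
      have hd : 0 < s - τ := by linarith [hτ.2]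
      have h3 := half_le_one_sub_exp_neg (x := B * (s - τ)) (by positivity)
        (le_trans (mul_le_mul_of_nonneg_left (by linarith [hτ.1]) hB0.le) hrB)
      have h4 : X * B / 2 * (s - τ) ≤ p s - p τ :=
        le_trans (by nlinarith) (hdiff τ hτ0 hτ.2.le)
      calc X * B / 2 * (s - τ) ^ (-α) = (s - τ) ^ (-α - 1) * (X * B / 2 * (s - τ)) := by
            rw [show -α = (-α - 1) + 1 by ring, Real.rpow_add_one hd.ne' (-α - 1)]
            ring_nf
        _ ≤ _ := mul_le_mul_of_nonneg_left h4 (Real.rpow_nonneg hd.le _)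
    linarith
  have hmain := h s hs0 hs.2
  rw [integral_caputoMeasure hα0 hs0 hint, hps] at hmain
  have hα1' : 0 < 1 - α := by linarith
  have hx1 : X / 2 ≤ X - p 0 := by
    have : 1 ≤ Real.exp (B * s) := Real.one_le_exp (by positivity)
    nlinarith
  have hsα : 0 < s ^ (-α) := Real.rpow_pos_of_pos hs0 _
  rw [hps] at hI
  simp only [smul_eq_mul] at hmain hI
  have hfin : s ^ (-α) * (X / 2) + α * (X * B / 2 * (r ^ (1 - α) / (1 - α))) ≤
      A * (1 / (1 - α)) * X := by
    calc _ ≤ s ^ (-α) * (X - p 0) +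
          α * ∫ τ in (0 : ℝ)..s, (s - τ) ^ (-α - 1) * (X - p τ) :=
          add_le_add (mul_le_mul_of_nonneg_left hx1 hsα.le) (mul_le_mul_of_nonneg_left hI hα0.le)
      _ ≤ _ := hmain
      _ ≤ _ := mul_le_mul_of_nonneg_right
          (mul_le_mul_of_nonneg_left (Gamma_one_sub_le hα0.le hα1) hA) hX0.le
  -- The kernel integral and the bound for `Γ(1 - α)` both carry `1 / (1 - α)`. Cancelling it is
  -- what makes the constants uniform as `α → 1`.
  have hfin2 : (1 - α) * s ^ (-α) + α * (B * r ^ (1 - α)) ≤ 2 * A := by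
    have h5 := mul_le_mul_of_nonneg_left hfin (show 0 ≤ 2 * (1 - α) / X by positivity)
    have e1 : 2 * (1 - α) / X * (s ^ (-α) * (X / 2) + α * (X * B / 2 * (r ^ (1 - α) / (1 - α)))) =
        (1 - α) * s ^ (-α) + α * (B * r ^ (1 - α)) := by field_simp
    have e2 : 2 * (1 - α) / X * (A * (1 / (1 - α)) * X) = 2 * A := by field_simp
    rwa [e1, e2] at h5
  -- This yields `B^α ≤ 4A`, whereas `B ≥ 1`, `α ≥ 1/2` and `B > (4A)²` force `B^α ≥ √B > 4A`.
  have h6 := rpow_le_kernel_sum hα hα1 hB0 hs0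
  have h7 : B ^ (1 / 2 : ℝ) ≤ B ^ α := Real.rpow_le_rpow_of_exponent_le hB1 hα
  have h8 : 4 * A < B ^ (1 / 2 : ℝ) := by
    rw [← Real.sqrt_eq_rpow]
    exact Real.lt_sqrt_of_sq_lt hB
  linarith

end

end TFCH

/-! ### Fractional gradient flows of semiconvex energies in a Hilbert space. -/

namespace TFCH

noncomputable section

variable {W : Type*} [NormedAddCommGroup W] [InnerProductSpace ℝ W]

/-- A solution `V` of the fractional gradient flow `∂_t^α V = w ∈ -γ ∂e(V)`, `V(0) = 0`, of an energy
`e ≥ 0` for which `e + κ‖·‖²` is convex; here `f t = e (V t) + κ ‖V t‖²`. -/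
structure IsFractionalFlow (α κ γ : ℝ) (V w : ℝ → W) (f : ℝ → ℝ) : Prop where
  admissible : CaputoAdmissible V
  zero : V 0 = 0
  tendsto_zero : Tendsto V (𝓝[>] 0) (𝓝 0)
  admissible_energy : CaputoAdmissible f
  energy_near_zero : ∀ᶠ t in 𝓝[>] (0 : ℝ), f t ≤ f 0 + 1
  caputo_eq : ∀ t, 0 < t → ∫ τ, (V t - V τ) ∂caputoMeasure α t = Real.Gamma (1 - α) • w t
  le_energy : ∀ t, 0 ≤ t → κ * ‖V t‖ ^ 2 ≤ f t
  subgradient : ∀ a b, 0 < a → 0 ≤ b →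
    f a - f b ≤ inner ℝ (-(1 / γ) • w a + (2 * κ) • V a) (V a - V b)

namespace IsFractionalFlow

variable {α κ γ : ℝ} {V w : ℝ → W} {f : ℝ → ℝ}

theorem energy_nonneg (h : IsFractionalFlow α κ γ V w f) (hκ : 0 ≤ κ) {t : ℝ} (ht : 0 ≤ t) :
    0 ≤ f t :=
  (by positivity : 0 ≤ κ * ‖V t‖ ^ 2).trans (h.le_energy t ht)

/-- The subgradient inequality between `t` and `0` leaves the term `2κ‖V t‖²`, which is at most `2 f
t`. -/
theorem inner_le (h : IsFractionalFlow α κ γ V w f) (hγ : 0 < γ) {t : ℝ} (ht : 0 < t) :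
    inner ℝ (V t) (w t) ≤ γ * (f 0 + f t) := by
  have h1 := h.subgradient t 0 ht le_rfl
  rw [h.zero, sub_zero, inner_add_left, real_inner_smul_left, real_inner_smul_left,
    real_inner_self_eq_norm_sq, real_inner_comm] at h1
  have h2 := h.le_energy t ht.le
  have h3 : 1 / γ * inner ℝ (V t) (w t) ≤ f 0 + f t := by linarith
  rw [one_div, inv_mul_le_iff₀ hγ] at h3
  exact h3

theorem monotone (h : IsFractionalFlow α κ γ V w f) (hγ : 0 < γ) {a b : ℝ} (ha : 0 < a)
    (hb : 0 < b) : inner ℝ (V a - V b) (w a - w b) ≤ 2 * κ * γ * ‖V a - V b‖ ^ 2 := by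
  have h1 := h.subgradient a b ha hb.le
  have h2 := h.subgradient b a hb ha.le
  have h3 : inner ℝ (-(1 / γ) • w b + (2 * κ) • V b) (V b - V a) =
      -inner ℝ (-(1 / γ) • w b + (2 * κ) • V b) (V a - V b) := by
    rw [← inner_neg_right, neg_sub]
  rw [h3] at h2
  have h4 : 0 ≤ inner ℝ ((-(1 / γ) • w a + (2 * κ) • V a) - (-(1 / γ) • w b + (2 * κ) • V b))
      (V a - V b) := by
    rw [inner_sub_left]; linarith
  have h5 : (-(1 / γ) • w a + (2 * κ) • V a) - (-(1 / γ) • w b + (2 * κ) • V b) =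
      -(1 / γ) • (w a - w b) + (2 * κ) • (V a - V b) := by
    rw [smul_sub, smul_sub]; abel
  rw [h5, inner_add_left, real_inner_smul_left, real_inner_smul_left,
    real_inner_self_eq_norm_sq, real_inner_comm] at h4
  have h6 : 1 / γ * inner ℝ (V a - V b) (w a - w b) ≤ 2 * κ * ‖V a - V b‖ ^ 2 := by linarith
  rw [one_div, inv_mul_le_iff₀ hγ] at h6
  linarith

variable [CompleteSpace W]

/-- Energy dissipation: the subgradient inequality is integrated against the positive Caputo
measure, which turns `V t - V τ` into `Γ(1-α) w t`. The term `-‖w t‖²/γ` is what later absorbs the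
error of the time dilation. -/
theorem caputo_energy_le (h : IsFractionalFlow α κ γ V w f) (hα : 0 < α) (hα1 : α < 1)
    (hκ : 0 ≤ κ) (hγ : 0 < γ) {t : ℝ} (ht : 0 < t) :
    ∫ τ, (f t - f τ) ∂caputoMeasure α t ≤
      Real.Gamma (1 - α) * (-(‖w t‖ ^ 2 / γ) + 2 * κ * γ * (f 0 + f t)) := by
  have hG : 0 < Real.Gamma (1 - α) := Real.Gamma_pos_of_pos (by linarith)
  have hi := h.admissible.integrable hα hα1 ht
  calc ∫ τ, (f t - f τ) ∂caputoMeasure α t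
      ≤ ∫ τ, inner ℝ (-(1 / γ) • w t + (2 * κ) • V t) (V t - V τ) ∂caputoMeasure α t := by
        refine integral_mono_ae (h.admissible_energy.integrable hα hα1 ht) (hi.const_inner _) ?_
        filter_upwards [ae_caputoMeasure_mem_Icc ht] with τ hτ
        exact h.subgradient t τ ht hτ.1
    _ = Real.Gamma (1 - α) * (-(‖w t‖ ^ 2 / γ) + 2 * κ * inner ℝ (V t) (w t)) := by
        rw [integral_inner hi, h.caputo_eq t ht, real_inner_smul_right, inner_add_left,
          real_inner_smul_left, real_inner_smul_left, real_inner_self_eq_norm_sq]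
        ring
    _ ≤ _ := by
        refine mul_le_mul_of_nonneg_left ?_ hG.le
        have := mul_le_mul_of_nonneg_left (h.inner_le hγ ht) (show 0 ≤ 2 * κ by positivity)
        linarith

theorem energy_le (h : IsFractionalFlow α κ γ V w f) (hα : 1 / 2 ≤ α) (hα1 : α < 1)
    (hκ : 0 ≤ κ) (hγ : 0 < γ) {t T : ℝ} (ht : 0 ≤ t) (htT : t ≤ T) :
    f t ≤ 2 * (2 * f 0 + 1) * Real.exp (((4 * (2 * κ * γ)) ^ 2 + 1) * T) := by
  have hf0 := h.energy_nonneg hκ (le_refl 0)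
  have hG : 0 < Real.Gamma (1 - α) := Real.Gamma_pos_of_pos (by linarith)
  have hE : Real.exp (((4 * (2 * κ * γ)) ^ 2 + 1) * t) ≤
      Real.exp (((4 * (2 * κ * γ)) ^ 2 + 1) * T) :=
    Real.exp_le_exp.2 (mul_le_mul_of_nonneg_left htT (by positivity))
  have hE1 : 1 ≤ Real.exp (((4 * (2 * κ * γ)) ^ 2 + 1) * t) := Real.one_le_exp (by positivity)
  rcases ht.eq_or_lt with rfl | ht0
  · nlinarith
  -- The shift by `f 0 + 1` makes the initial value positive, absorbs the source `f 0` and leaves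
  -- room for the possible increase by `1` just after time `0`.
  have key := caputo_gronwall (A := 2 * κ * γ) (T := T) hα hα1 (by positivity)
    (le_add_of_nonneg_left (sq_nonneg _)) (lt_add_one ((4 * (2 * κ * γ)) ^ 2))
    (h.admissible_energy.add_const (f 0 + 1)) (by linarith)
    (by
      filter_upwards [h.energy_near_zero] with s hs
      linarith)
    (fun s hs _ => by
      have h1 := h.caputo_energy_le (by linarith) hα1 hκ hγ hs
      simp only [add_sub_add_right_eq_sub]
      refine h1.trans ?_
      rw [mul_comm (2 * κ * γ) (Real.Gamma (1 - α)), mul_assoc (Real.Gamma (1 - α))]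
      refine mul_le_mul_of_nonneg_left ?_ hG.le
      have h2 : 0 ≤ ‖w s‖ ^ 2 / γ := by positivity
      have h3 : 0 ≤ 2 * κ * γ := by positivity
      linarith) t ht0 htT
  have := mul_le_mul_of_nonneg_left hE (show 0 ≤ 2 * (2 * f 0 + 1) by linarith)
  rw [show f 0 + (f 0 + 1) = 2 * f 0 + 1 by ring] at key
  linarith

/-- The difference `Z t = V (l t) - V t` has Caputo derivative `(w (l t) - w t) + (l^α - 1) w (l
t)`. Monotonicity controls the first part; the second costs `η‖w (l t)‖² + ‖Z‖²`, and the
dissipation of `γ η l^(-α) f (l t)` pays for the `w` term. The weight `l^(-α)` cancels the factor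
`l^α` from the scaling. -/
theorem dilation_sq_le (h : IsFractionalFlow α κ γ V w f) (hα : 1 / 2 ≤ α) (hα1 : α < 1)
    (hκ : 0 ≤ κ) (hγ : 0 < γ) {l S C c : ℝ} (hl : 1 < l)
    (hC : ∀ s, 0 ≤ s → s ≤ l * S → f s ≤ C)
    (hc : c = 2 * κ * γ ^ 2 * (f 0 + C) + γ + 1) {s : ℝ} (hs : 0 < s) (hsS : s ≤ S) :
    ‖V (l * s) - V s‖ ^ 2 ≤
      2 * (γ * f 0 + c) * Real.exp (((4 * (4 * κ * γ + 1)) ^ 2 + 1) * s) * (l - 1) ^ 2 := by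
  have hα0 : 0 < α := by linarith
  have hl0 : 0 < l := by linarith
  have hf0 := h.energy_nonneg hκ (le_refl 0)
  have hC0 : 0 ≤ C := hf0.trans (hC 0 le_rfl (by nlinarith))
  have hc0 : 0 < c := by rw [hc]; positivity
  have hG : 0 < Real.Gamma (1 - α) := Real.Gamma_pos_of_pos (by linarith)
  have hlα : 1 < l ^ α := Real.one_lt_rpow hl hα0
  have hlα' : l ^ α ≤ l := by
    simpa using Real.rpow_le_rpow_of_exponent_le hl.le hα1.le
  set η := (l ^ α - 1) ^ 2 with hη
  have hη0 : 0 < η := by have : 0 < l ^ α - 1 := by linarith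
                         positivity
  have hηl : η ≤ (l - 1) ^ 2 := by
    rw [hη]; exact pow_le_pow_left₀ (by linarith) (by linarith) 2
  have hli : l ^ (-α) * l ^ α = 1 := by rw [← Real.rpow_add hl0]; simp
  have hli0 : 0 < l ^ (-α) := Real.rpow_pos_of_pos hl0 _
  have hli1 : l ^ (-α) ≤ 1 := by nlinarith
  have admZ := (h.admissible.comp_mul hl0).sub h.admissible
  have admF := h.admissible_energy.comp_mul hl0
  have hcoef : 0 ≤ γ * η * l ^ (-α) := by positivity
  -- In `c`, the part `2κγ²(f 0 + C)` covers the source in the energy inequality, and `γ + 1` covers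
  -- the bound near time `0`.
  have admp := (admZ.norm_sq.add (admF.const_mul hcoef)).add_const (c * η)
  have hsum : γ * η * l ^ (-α) ≤ γ * η := mul_le_of_le_one_right (by positivity) hli1
  have key := caputo_gronwall (A := 4 * κ * γ + 1) (T := S) hα hα1 (by positivity)
    (le_add_of_nonneg_left (sq_nonneg _)) (lt_add_one ((4 * (4 * κ * γ + 1)) ^ 2))
    admp (by
      simp only [mul_zero, sub_self, norm_zero]
      positivity)
    (by
      have ht : Tendsto (fun t => l * t) (𝓝[>] 0) (𝓝[>] 0) := by
        refine tendsto_nhdsWithin_iff.2 ⟨?_, ?_⟩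
        · have : Tendsto (fun t => l * t) (𝓝 0) (𝓝 (l * 0)) := Continuous.tendsto (by fun_prop) 0
          rw [mul_zero] at this
          exact this.mono_left nhdsWithin_le_nhds
        · filter_upwards [self_mem_nhdsWithin] with t ht
          exact mul_pos hl0 ht
      have hZ : Tendsto (fun t => ‖V (l * t) - V t‖ ^ 2) (𝓝[>] 0) (𝓝 0) := by
        simpa using (((h.tendsto_zero.comp ht).sub h.tendsto_zero).norm.pow 2)
      filter_upwards [ht.eventually h.energy_near_zero, hZ.eventually_le_const hη0] with t h1 h2
      have h3 := mul_le_mul_of_nonneg_left h1 hcoef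
      simp only [mul_zero, sub_self, norm_zero]
      have h4 : (γ + 1) * η ≤ c * η := by
        refine mul_le_mul_of_nonneg_right ?_ hη0.le
        rw [hc]
        have : 0 ≤ 2 * κ * γ ^ 2 * (f 0 + C) := by positivity
        linarith
      have h5 : 0 ≤ γ * η * l ^ (-α) * f 0 := by positivity
      linarith)
    (fun t ht htS => by
      have hlt : 0 < l * t := mul_pos hl0 ht
      have hZi := admZ.integrable hα0 hα1 ht
      have e1 : ∀ τ, ‖V (l * t) - V t‖ ^ 2 + γ * η * l ^ (-α) * f (l * t) + c * η -
          (‖V (l * τ) - V τ‖ ^ 2 + γ * η * l ^ (-α) * f (l * τ) + c * η) =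
          (‖V (l * t) - V t‖ ^ 2 - ‖V (l * τ) - V τ‖ ^ 2) +
            γ * η * l ^ (-α) * (f (l * t) - f (l * τ)) := fun τ => by ring
      simp only [e1]
      rw [integral_add (admZ.norm_sq.integrable hα0 hα1 ht)
        ((admF.integrable hα0 hα1 ht).const_mul _), integral_const_mul,
        integral_caputoMeasure_comp_mul h.admissible_energy hα0 hα1 ht hl0, smul_eq_mul,
        mul_assoc (γ * η), ← mul_assoc (l ^ (-α)), hli, one_mul]
      have h1 : ∫ τ, (‖V (l * t) - V t‖ ^ 2 - ‖V (l * τ) - V τ‖ ^ 2) ∂caputoMeasure α t ≤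
          2 * inner ℝ (V (l * t) - V t)
            (∫ τ, (V (l * t) - V t - (V (l * τ) - V τ)) ∂caputoMeasure α t) := by
        rw [← integral_inner hZi, ← integral_const_mul]
        refine integral_mono (admZ.norm_sq.integrable hα0 hα1 ht)
          ((hZi.const_inner _).const_mul _) fun τ => ?_
        simp only
        -- This is `‖x‖² - ‖y‖² ≤ 2⟨x, x - y⟩`, the convexity of the squared norm.
        set x := V (l * t) - V t
        set y := V (l * τ) - V τ
        have e2 := norm_sub_sq_real x y
        have e3 : inner ℝ x (x - y) = ‖x‖ ^ 2 - inner ℝ x y := by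
          rw [inner_sub_right, real_inner_self_eq_norm_sq]
        rw [e3]
        nlinarith [sq_nonneg ‖x - y‖]
      have h2 : ∫ τ, (V (l * t) - V t - (V (l * τ) - V τ)) ∂caputoMeasure α t =
          Real.Gamma (1 - α) • ((w (l * t) - w t) + (l ^ α - 1) • w (l * t)) := by
        have e2 : ∀ τ, V (l * t) - V t - (V (l * τ) - V τ) =
            (V (l * t) - V (l * τ)) - (V t - V τ) := fun τ => by abel
        simp only [e2]
        rw [integral_sub ((h.admissible.comp_mul hl0).integrable hα0 hα1 ht)
          (h.admissible.integrable hα0 hα1 ht),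
          integral_caputoMeasure_comp_mul h.admissible hα0 hα1 ht hl0, h.caputo_eq t ht,
          h.caputo_eq _ hlt]
        module
      have h3 := h.monotone hγ hlt ht
      have h4 := h.caputo_energy_le hα0 hα1 hκ hγ hlt
      have hfl := hC (l * t) hlt.le (mul_le_mul_of_nonneg_left htS hl0.le)
      have h5 : 2 * inner ℝ (V (l * t) - V t) ((l ^ α - 1) • w (l * t)) ≤
          η * ‖w (l * t)‖ ^ 2 + ‖V (l * t) - V t‖ ^ 2 := by
        rw [real_inner_smul_right]
        have e2 := real_inner_le_norm (V (l * t) - V t) (w (l * t))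
        have e3 := mul_le_mul_of_nonneg_left e2 (show 0 ≤ l ^ α - 1 by linarith)
        rw [hη]
        nlinarith [sq_nonneg ((l ^ α - 1) * ‖w (l * t)‖ - ‖V (l * t) - V t‖)]
      rw [h2, real_inner_smul_right, inner_add_right] at h1
      have h6 : γ * η * ∫ τ, (f (l * t) - f τ) ∂caputoMeasure α (l * t) ≤
          Real.Gamma (1 - α) * (-(η * ‖w (l * t)‖ ^ 2) + 2 * κ * γ ^ 2 * (f 0 + C) * η) := by
        refine (mul_le_mul_of_nonneg_left h4 (by positivity : 0 ≤ γ * η)).trans ?_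
        have e2 : γ * η * (Real.Gamma (1 - α) * (-(‖w (l * t)‖ ^ 2 / γ) +
            2 * κ * γ * (f 0 + f (l * t)))) = Real.Gamma (1 - α) * (-(η * ‖w (l * t)‖ ^ 2) +
            2 * κ * γ ^ 2 * η * (f 0 + f (l * t))) := by
          field_simp
        rw [e2]
        refine mul_le_mul_of_nonneg_left ?_ hG.le
        have e3 := mul_le_mul_of_nonneg_left hfl (show 0 ≤ 2 * κ * γ ^ 2 * η by positivity)
        linarith
      have h7 := h.energy_nonneg hκ hlt.le
      have h8 : 0 ≤ γ * η * l ^ (-α) * f (l * t) := by positivity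
      refine (add_le_add h1 h6).trans ?_
      rw [mul_comm (4 * κ * γ + 1) (Real.Gamma (1 - α)), mul_assoc (Real.Gamma (1 - α)),
        mul_left_comm 2, ← mul_add]
      refine mul_le_mul_of_nonneg_left ?_ hG.le
      have h9 : 2 * κ * γ ^ 2 * (f 0 + C) * η ≤ c * η := by
        refine mul_le_mul_of_nonneg_right ?_ hη0.le
        rw [hc]; linarith
      have h10 : 0 ≤ 4 * κ * γ * (γ * η * l ^ (-α) * f (l * t) + c * η) := by positivity
      linarith)
    s hs hsS
  simp only [mul_zero, sub_self, norm_zero] at key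
  have h1 := h.energy_nonneg hκ (mul_pos hl0 hs).le
  have h2 : 0 ≤ γ * η * l ^ (-α) * f (l * s) := by positivity
  have h3 : 0 ≤ c * η := by positivity
  have hX := Real.exp_pos (((4 * (4 * κ * γ + 1)) ^ 2 + 1) * s)
  set X := Real.exp (((4 * (4 * κ * γ + 1)) ^ 2 + 1) * s)
  have h4 : 0 ^ 2 + γ * η * l ^ (-α) * f 0 + c * η ≤ (γ * f 0 + c) * (l - 1) ^ 2 := by
    have e1 := mul_le_mul_of_nonneg_right hsum hf0
    have e2 := mul_le_mul_of_nonneg_left hηl (show 0 ≤ γ * f 0 + c by positivity)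
    linarith
  have h5 := mul_le_mul_of_nonneg_right h4 hX.le
  linarith

end IsFractionalFlow

/-- A Lipschitz bound for fractional gradient flows at a positive time that is uniform in
`α ∈ [1/2, 1)`. -/
theorem exists_lipschitz_fractionalFlow [CompleteSpace W] {κ γ E₀ t : ℝ} (hκ : 0 < κ) (hγ : 0 < γ)
    (ht : 0 < t) : ∃ K, ∀ (α : ℝ) (V w : ℝ → W) (f : ℝ → ℝ), 1 / 2 ≤ α → α < 1 →
      IsFractionalFlow α κ γ V w f → f 0 = E₀ →
      ∀ τ, 0 ≤ τ → τ ≤ t → ‖V t - V τ‖ ≤ K * (t - τ) := by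
  set C := 2 * (2 * E₀ + 1) * Real.exp (((4 * (2 * κ * γ)) ^ 2 + 1) * (2 * t)) with hC
  set c := 2 * κ * γ ^ 2 * (E₀ + C) + γ + 1 with hc
  set Q := 2 * (γ * E₀ + c) * Real.exp (((4 * (4 * κ * γ + 1)) ^ 2 + 1) * t) with hQ
  -- The first summand serves `τ < t/2`, where boundedness of `V` suffices. The second serves `τ ≥
  -- t/2`, where `l = t / τ ≤ 2`; this is why `C` bounds the energy up to time `2t`.
  refine ⟨(2 * √(C / κ) + √Q) * (2 / t), fun α V w f hα hα1 h hE τ h0 h1 => ?_⟩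
  have hE0 : 0 ≤ E₀ := hE ▸ h.energy_nonneg hκ.le (le_refl 0)
  have hC0 : 0 ≤ C := by positivity
  have hc0 : 0 < c := by positivity
  have hfC : ∀ s, 0 ≤ s → s ≤ 2 * t → f s ≤ C := fun s hs hs' => by
    have := h.energy_le hα hα1 hκ.le hγ hs hs'
    rwa [hE] at this
  have hV : ∀ s, 0 ≤ s → s ≤ 2 * t → ‖V s‖ ≤ √(C / κ) := fun s hs hs' => by
    refine Real.le_sqrt_of_sq_le ?_
    rw [le_div_iff₀ hκ, mul_comm]
    exact (h.le_energy s hs).trans (hfC s hs hs')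
  have hd : 0 ≤ t - τ := sub_nonneg.2 h1
  rw [mul_assoc, add_mul]
  rcases lt_or_ge τ (t / 2) with h2 | h2
  · have h3 : 1 ≤ 2 / t * (t - τ) := by
      rw [div_mul_eq_mul_div, le_div_iff₀ ht]; linarith
    have h4 := norm_sub_le (V t) (V τ)
    have h5 := hV t ht.le (by linarith)
    have h6 := hV τ h0 (by linarith)
    have h7 : 0 ≤ √Q * (2 / t * (t - τ)) := by positivity
    have h8 := mul_le_mul_of_nonneg_left h3 (show 0 ≤ 2 * √(C / κ) by positivity)
    linarith
  · have hτ : 0 < τ := by linarith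
    have h7 : 0 ≤ 2 * √(C / κ) * (2 / t * (t - τ)) := by positivity
    rcases h1.eq_or_lt with rfl | h3
    · simp
    have hl : 1 < t / τ := (one_lt_div hτ).2 h3
    have hl2 : t / τ ≤ 2 := (div_le_iff₀ hτ).2 (by linarith)
    have key := h.dilation_sq_le (S := t) (C := C) (c := c) hα hα1 hκ.le hγ hl
      (fun s hs hs' => hfC s hs (hs'.trans (mul_le_mul_of_nonneg_right hl2 ht.le)))
      (by rw [hE]) hτ h1
    rw [div_mul_cancel₀ _ hτ.ne', hE] at key
    have hQ' : 2 * (γ * E₀ + c) * Real.exp (((4 * (4 * κ * γ + 1)) ^ 2 + 1) * τ) ≤ Q := by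
      refine mul_le_mul_of_nonneg_left (Real.exp_le_exp.2 ?_) (by positivity)
      exact mul_le_mul_of_nonneg_left h1 (by positivity)
    have h4 : t / τ - 1 ≤ 2 / t * (t - τ) := by
      rw [div_sub_one hτ.ne', div_le_iff₀ hτ]
      have : 1 ≤ 2 / t * τ := by rw [div_mul_eq_mul_div, le_div_iff₀ ht]; linarith
      nlinarith
    have h5 : ‖V t - V τ‖ ≤ √Q * (t / τ - 1) := by
      have hQ0 : 0 ≤ Q := by positivity
      have hx : 0 ≤ √Q * (t / τ - 1) := mul_nonneg (Real.sqrt_nonneg Q) (by linarith)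
      refine (abs_le_of_sq_le_sq' ?_ hx).2
      rw [mul_pow, Real.sq_sqrt hQ0]
      exact key.trans (mul_le_mul_of_nonneg_right hQ' (sq_nonneg _))
    have h6 := mul_le_mul_of_nonneg_left h4 (Real.sqrt_nonneg Q)
    linarith

end

end TFCH

/-! ### `H₀¹(Ω)` as a graph space, the Poincaré inequality and the Poisson problem. -/

namespace TFCH

noncomputable section

variable {d : ℕ} {Ω : Set (Space d)}

theorem gradient_apply {φ : Space d → ℝ} {x : Space d} (h : DifferentiableAt ℝ φ x) (i : Fin d) :
    gradient φ x i = fderiv ℝ φ x (EuclideanSpace.single i 1) := by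
  have hg : inner ℝ (gradient φ x) (EuclideanSpace.single i (1 : ℝ)) =
      fderiv ℝ φ x (EuclideanSpace.single i 1) :=
    (congrArg (fun L : Space d →L[ℝ] ℝ => L (EuclideanSpace.single i 1))
      h.hasGradientAt.hasFDerivAt.fderiv).symm
  rw [← hg, EuclideanSpace.inner_single_right]
  simp

theorem IsTestFunction.differentiable {φ : Space d → ℝ} (h : IsTestFunction Ω φ) :
    Differentiable ℝ φ :=
  h.contDiff.differentiable (by simp)

theorem IsTestFunction.mul_left {φ g : Space d → ℝ} (h : IsTestFunction Ω φ)
    (hg : ContDiff ℝ (⊤ : ℕ∞) g) : IsTestFunction Ω (fun x => g x * φ x) :=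
  ⟨hg.mul h.contDiff, h.hasCompactSupport.mul_left,
    (tsupport_mul_subset_right).trans h.tsupport_subset⟩

/-- `{(φ, ∇φ) | φ ∈ C_c^∞(Ω)}`. -/
def testGraph (Ω : Set (Space d)) : Submodule ℝ (L2 Ω × L2vec Ω) where
  carrier := {p | ∃ φ : Space d → ℝ, IsTestFunction Ω φ ∧
    p.1 =ᵐ[volume.restrict Ω] φ ∧ p.2 =ᵐ[volume.restrict Ω] gradient φ}
  add_mem' := by
    rintro p q ⟨φ, hφ, h1, h2⟩ ⟨ψ, hψ, h3, h4⟩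
    refine ⟨φ + ψ, ⟨hφ.contDiff.add hψ.contDiff, hφ.hasCompactSupport.add hψ.hasCompactSupport,
      (tsupport_add φ ψ).trans (union_subset hφ.tsupport_subset hψ.tsupport_subset)⟩, ?_, ?_⟩
    · exact (Lp.coeFn_add p.1 q.1).trans (h1.add h3)
    · refine (Lp.coeFn_add p.2 q.2).trans ((h2.add h4).trans (ae_of_all _ fun x => ?_))
      ext i
      rw [gradient_apply ((hφ.differentiable x).add (hψ.differentiable x)), Pi.add_apply,
        PiLp.add_apply, gradient_apply (hφ.differentiable x), gradient_apply (hψ.differentiable x),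
        fderiv_add (hφ.differentiable x) (hψ.differentiable x)]
      rfl
  zero_mem' := by
    refine ⟨0, ⟨contDiff_const, HasCompactSupport.zero, ?_⟩, Lp.coeFn_zero _ _ _, ?_⟩
    · simp [tsupport]
    · refine (Lp.coeFn_zero _ _ _).trans (ae_of_all _ fun x => ?_)
      ext i
      have h0 : (0 : Space d → ℝ) = fun _ => (0 : ℝ) := rfl
      rw [h0, gradient_apply (differentiableAt_const (0 : ℝ))]
      simp
  smul_mem' := by
    rintro c p ⟨φ, hφ, h1, h2⟩
    have e : (fun x => c * φ x) = c • φ := rfl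
    refine ⟨fun x => c * φ x, hφ.mul_left contDiff_const, ?_, ?_⟩
    · exact (Lp.coeFn_smul c p.1).trans (h1.const_smul c)
    · refine (Lp.coeFn_smul c p.2).trans ((h2.const_smul c).trans (ae_of_all _ fun x => ?_))
      ext i
      rw [gradient_apply ((hφ.differentiable x).const_mul c), e,
        fderiv_const_smul (hφ.differentiable x)]
      simp [gradient_apply (hφ.differentiable x)]

/-- `H₀¹(Ω)` as a closed subspace of `L²(Ω) × L²(Ω; ℝ^d)`. -/
def sobolevGraph (Ω : Set (Space d)) : Submodule ℝ (L2 Ω × L2vec Ω) :=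
  (testGraph Ω).topologicalClosure

theorem isClosed_sobolevGraph : IsClosed (sobolevGraph Ω : Set (L2 Ω × L2vec Ω)) :=
  (testGraph Ω).isClosed_topologicalClosure

theorem MemH10.grad_mem (hΩ : IsOpen Ω) {v : L2 Ω} (h : MemH10 Ω v) : (v, grad Ω v) ∈ H10 Ω := by
  obtain ⟨G, hG⟩ := h
  rwa [grad_eq hΩ hG]

theorem MemH10.sub {v w : L2 Ω} (hv : MemH10 Ω v) (hw : MemH10 Ω w) : MemH10 Ω (v - w) := by
  obtain ⟨G, hG⟩ := hv
  obtain ⟨G', hG'⟩ := hw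
  exact ⟨G - G', (sobolevGraph Ω).sub_mem hG hG'⟩

theorem grad_sub (hΩ : IsOpen Ω) {v w : L2 Ω} (hv : MemH10 Ω v) (hw : MemH10 Ω w) :
    grad Ω (v - w) = grad Ω v - grad Ω w :=
  grad_eq hΩ ((sobolevGraph Ω).sub_mem (hv.grad_mem hΩ) (hw.grad_mem hΩ))

/-- Integrating by parts against `x_i φ` gives `‖φ‖² = -2 ∫ x_i φ ∂_i φ`, and `|x_i| ≤ R` on `Ω`. -/
theorem norm_le_of_mem_testGraph (i : Fin d) {R : ℝ} (hR : 0 ≤ R) (hΩR : ∀ x ∈ Ω, ‖x‖ ≤ R)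
    (hΩ : IsOpen Ω) {p : L2 Ω × L2vec Ω} (hp : p ∈ testGraph Ω) : ‖p.1‖ ≤ 2 * R * ‖p.2‖ := by
  obtain ⟨φ, hφ, h1, h2⟩ := hp
  have hpH : p ∈ H10 Ω := subset_closure ⟨φ, hφ, h1, h2⟩
  set e : Space d := EuclideanSpace.single i 1 with he
  have hxi : ContDiff ℝ (⊤ : ℕ∞) (fun x : Space d => x i) :=
    (EuclideanSpace.proj i : Space d →L[ℝ] ℝ).contDiff
  have hχ := hφ.mul_left hxi
  have hb : MemLp (fun x => (x i * φ x) • e) 2 (volume.restrict Ω) :=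
    (hχ.contDiff.continuous.smul continuous_const).memLp_of_hasCompactSupport
      hχ.hasCompactSupport.smul_right
  have hJ : inner ℝ (hb.toLp _) p.2 = ∫ x in Ω, x i * φ x * p.2 x i := by
    rw [L2.inner_def]
    refine integral_congr_ae ?_
    filter_upwards [hb.coeFn_toLp] with x hx
    rw [hx, inner_smul_left, he, EuclideanSpace.inner_single_left]
    simp
  have hsq : ‖p.1‖ ^ 2 = ∫ x in Ω, φ x * φ x := by
    rw [← real_inner_self_eq_norm_sq, L2.inner_def]
    refine integral_congr_ae ?_
    filter_upwards [h1] with x hx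
    rw [hx]
    simp [sq]
  have hibp := integral_test_mul_grad hχ i hpH
  have hi1 : Integrable (fun x => φ x * φ x) (volume.restrict Ω) :=
    ((hφ.contDiff.continuous.mul hφ.contDiff.continuous).integrable_of_hasCompactSupport
      hφ.hasCompactSupport.mul_right).restrict
  have hi2 : Integrable (fun x => x i * φ x * fderiv ℝ φ x e) (volume.restrict Ω) := by
    have hd : Continuous (fun x => fderiv ℝ φ x e) :=
      (hφ.contDiff.continuous_fderiv (by simp)).clm_apply continuous_const
    exact ((hχ.contDiff.continuous.mul hd).integrable_of_hasCompactSupport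
      hχ.hasCompactSupport.mul_right).restrict
  have e1 : ∫ x in Ω, x i * φ x * p.2 x i = ∫ x in Ω, x i * φ x * fderiv ℝ φ x e := by
    refine integral_congr_ae ?_
    filter_upwards [h2] with x hx
    rw [hx, gradient_apply (hφ.differentiable x)]
  have e2 : ∫ x in Ω, fderiv ℝ (fun x => x i * φ x) x e * p.1 x =
      ∫ x in Ω, (φ x * φ x + x i * φ x * fderiv ℝ φ x e) := by
    refine integral_congr_ae ?_
    filter_upwards [h1] with x hx
    have hd1 : DifferentiableAt ℝ (fun x : Space d => x i) x := hxi.differentiable (by simp) x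
    have hd2 : fderiv ℝ (fun x : Space d => x i) x = EuclideanSpace.proj i :=
      (EuclideanSpace.proj i : Space d →L[ℝ] ℝ).fderiv
    rw [hx, fderiv_fun_mul hd1 (hφ.differentiable x), hd2]
    simp [he]
    ring
  have hkey : ‖p.1‖ ^ 2 = -2 * inner ℝ (hb.toLp _) p.2 := by
    rw [e2, integral_add hi1 hi2] at hibp
    rw [hJ, hsq]
    linarith [hibp, e1]
  have hnb : ‖hb.toLp _‖ ≤ R * ‖p.1‖ := by
    refine Lp.norm_le_mul_norm_of_ae_le_mul ?_
    filter_upwards [hb.coeFn_toLp, h1, ae_restrict_mem hΩ.measurableSet] with x hx hx1 hxΩ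
    rw [hx, hx1, norm_smul, he, PiLp.norm_single, norm_one, mul_one, norm_mul]
    exact mul_le_mul_of_nonneg_right ((PiLp.norm_apply_le x i).trans (hΩR x hxΩ)) (norm_nonneg _)
  have hcs := (abs_le.1 (abs_real_inner_le_norm (hb.toLp _) p.2)).1
  have h5 : ‖p.1‖ * ‖p.1‖ ≤ 2 * R * ‖p.2‖ * ‖p.1‖ := by
    have := mul_le_mul_of_nonneg_right hnb (norm_nonneg p.2)
    nlinarith
  rcases (norm_nonneg p.1).eq_or_lt with h0 | h0
  · rw [← h0]; positivity
  · exact le_of_mul_le_mul_right h5 h0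

/-- The Poincaré inequality. -/
theorem exists_poincare (hd : 0 < d) (hΩ : IsOpen Ω) (hΩb : Bornology.IsBounded Ω) :
    ∃ C, 0 ≤ C ∧ ∀ p ∈ H10 Ω, ‖p.1‖ ≤ C * ‖p.2‖ := by
  obtain ⟨R, hR⟩ := hΩb.exists_norm_le
  refine ⟨2 * |R|, by positivity, fun p hp => ?_⟩
  have : p ∈ {q : L2 Ω × L2vec Ω | ‖q.1‖ ≤ 2 * |R| * ‖q.2‖} := by
    refine closure_minimal (fun q hq => ?_) (isClosed_le (by fun_prop) (by fun_prop)) hp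
    exact norm_le_of_mem_testGraph ⟨0, hd⟩ (abs_nonneg R)
      (fun x hx => (hR x hx).trans (le_abs_self R)) hΩ hq
  exact this

/-- `A f = ∇ψ` for the weak solution `ψ ∈ H₀¹(Ω)` of `-Δψ = f`. -/
def IsPoissonGrad (Ω : Set (Space d)) (A : L2 Ω →L[ℝ] L2vec Ω) : Prop :=
  ∀ f : L2 Ω, (∃ ψ : L2 Ω, (ψ, A f) ∈ H10 Ω) ∧
    ∀ p ∈ H10 Ω, inner ℝ (A f) p.2 = inner ℝ f p.1

/-- By Poincaré, `(v, ∇v) ↦ ∇v` is bounded below, so the gradients form a closed subspace on which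
`B : ∇v ↦ v` is continuous. Its adjoint satisfies `⟨B* f, ∇v⟩ = ⟨f, v⟩`, which is the weak Poisson
equation. -/
theorem exists_isPoissonGrad (hd : 0 < d) (hΩ : IsOpen Ω) (hΩb : Bornology.IsBounded Ω) :
    ∃ A : L2 Ω →L[ℝ] L2vec Ω, IsPoissonGrad Ω A := by
  obtain ⟨C, hC, hP⟩ := exists_poincare hd hΩ hΩb
  have : CompleteSpace (sobolevGraph Ω) := isClosed_sobolevGraph.completeSpace_coe
  set S : sobolevGraph Ω →L[ℝ] L2vec Ω :=
    (ContinuousLinearMap.snd ℝ (L2 Ω) (L2vec Ω)).comp (sobolevGraph Ω).subtypeL with hS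
  have hanti : ∀ x : sobolevGraph Ω, ‖x‖ ≤ (⟨C + 1, by positivity⟩ : NNReal) * ‖S x‖ := by
    intro x
    have h1 := hP x.1 x.2
    have h2 : ‖x.1.2‖ ≤ (C + 1) * ‖x.1.2‖ := by nlinarith [norm_nonneg x.1.2]
    have h3 : ‖x.1.1‖ ≤ (C + 1) * ‖x.1.2‖ := by nlinarith [norm_nonneg x.1.2]
    exact max_le h3 h2
  have hS' : AntilipschitzWith _ S := S.antilipschitz_of_bound hanti
  have hclosed : IsClosed (LinearMap.range S.toLinearMap : Set (L2vec Ω)) := by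
    have := hS'.isClosed_range S.uniformContinuous
    rwa [LinearMap.coe_range]
  have : CompleteSpace (LinearMap.range S.toLinearMap) := hclosed.completeSpace_coe
  let e := LinearEquiv.ofInjective S.toLinearMap hS'.injective
  let B₀ : LinearMap.range S.toLinearMap →ₗ[ℝ] L2 Ω :=
    (LinearMap.fst ℝ (L2 Ω) (L2vec Ω)).comp ((sobolevGraph Ω).subtype.comp e.symm.toLinearMap)
  have heS : ∀ G, S (e.symm G) = G.1 := fun G => congrArg Subtype.val (e.apply_symm_apply G)
  let B : LinearMap.range S.toLinearMap →L[ℝ] L2 Ω := B₀.mkContinuous C fun G => by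
    have h1 := hP (e.symm G).1 (e.symm G).2
    have h2 : (e.symm G).1.2 = G.1 := heS G
    rw [h2] at h1
    exact h1
  refine ⟨(LinearMap.range S.toLinearMap).subtypeL.comp (ContinuousLinearMap.adjoint B),
    fun f => ⟨?_, fun p hp => ?_⟩⟩
  · obtain ⟨x, hx⟩ := (ContinuousLinearMap.adjoint B f).2
    refine ⟨x.1.1, ?_⟩
    have h2 : ((LinearMap.range S.toLinearMap).subtypeL.comp (ContinuousLinearMap.adjoint B)) f =
        x.1.2 := hx.symm
    rw [h2]
    exact x.2
  · let G : LinearMap.range S.toLinearMap := ⟨p.2, ⟨⟨p, hp⟩, rfl⟩⟩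
    have h1 : e.symm G = ⟨p, hp⟩ := (LinearEquiv.symm_apply_eq e).2 rfl
    have h2 : B G = p.1 := by
      change (e.symm G).1.1 = p.1
      rw [h1]
    have h3 := ContinuousLinearMap.adjoint_inner_left B G f
    exact h3.trans (congrArg (fun v => inner ℝ f v) h2)

theorem IsPoissonGrad.inner_grad (hΩ : IsOpen Ω) {A : L2 Ω →L[ℝ] L2vec Ω} (hA : IsPoissonGrad Ω A)
    (f : L2 Ω) {v : L2 Ω} (hv : MemH10 Ω v) : inner ℝ (A f) (grad Ω v) = inner ℝ f v :=
  (hA f).2 _ (hv.grad_mem hΩ)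

/-- Uniqueness: `A f - c ∇v` is the gradient of an `H₀¹` function and is orthogonal to itself. It
identifies `∇Ψ` (with `c = 1`) and `-γ∇μ` (with `c = -γ`) as values of `A`. -/
theorem IsPoissonGrad.eq_of_forall_inner {A : L2 Ω →L[ℝ] L2vec Ω} (hΩ : IsOpen Ω)
    (hA : IsPoissonGrad Ω A) {f v : L2 Ω} {c : ℝ} (hv : MemH10 Ω v)
    (h : ∀ φ, MemH10 Ω φ → inner ℝ f φ = c * inner ℝ (grad Ω v) (grad Ω φ)) :
    A f = c • grad Ω v := by
  obtain ⟨ψ, hψ⟩ := (hA f).1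
  have hmem : (ψ - c • v, A f - c • grad Ω v) ∈ H10 Ω :=
    (sobolevGraph Ω).sub_mem hψ ((sobolevGraph Ω).smul_mem c (hv.grad_mem hΩ))
  have h1 := (hA f).2 _ hmem
  have h2 := h _ ⟨_, hmem⟩
  rw [grad_eq hΩ hmem] at h2
  simp only at h1
  rw [h2, ← real_inner_smul_left, ← sub_eq_zero, ← inner_sub_left, inner_self_eq_zero,
    sub_eq_zero] at h1
  exact h1

theorem IsPoissonSolution.grad_eq_apply (hΩ : IsOpen Ω) {A : L2 Ω →L[ℝ] L2vec Ω}
    (hA : IsPoissonGrad Ω A) {f ψ : L2 Ω} (h : IsPoissonSolution Ω f ψ) : grad Ω ψ = A f := by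
  rw [hA.eq_of_forall_inner (c := 1) hΩ h.1 fun φ hφ => by rw [one_mul, h.2 φ hφ], one_smul]

theorem IsPotential.grad_sub_eq (hΩ : IsOpen Ω) {A : L2 Ω →L[ℝ] L2vec Ω} (hA : IsPoissonGrad Ω A)
    {u Ψ : ℝ → L2 Ω} (h : IsPotential Ω u Ψ) {t τ : ℝ} (ht : 0 ≤ t) (hτ : 0 ≤ τ) :
    grad Ω (Ψ t - Ψ τ) = A (u t - u 0) - A (u τ - u 0) := by
  rw [grad_sub hΩ (h t ht).1 (h τ hτ).1, (h t ht).grad_eq_apply hΩ hA, (h τ hτ).grad_eq_apply hΩ hA]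

end

end TFCH

/-! ### Functions whose derivative is bounded by `C t^(α-1)`. -/

namespace TFCH

noncomputable section

theorem rpow_sub_rpow_le_sub_rpow {α t τ : ℝ} (hα : 0 < α) (hα1 : α < 1) (hτ : 0 ≤ τ)
    (h : τ ≤ t) : t ^ α - τ ^ α ≤ (t - τ) ^ α := by
  have := Real.rpow_add_le_add_rpow (sub_nonneg.2 h) hτ hα.le hα1.le
  rw [sub_add_cancel] at this
  linarith

/-- From `τ^(α-1) ≥ t^(α-1)`. It gives a Lipschitz bound anchored at the later time `t` and valid
down to `τ = 0`, despite the singular derivative there. -/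
theorem rpow_sub_rpow_le_mul {α t τ : ℝ} (hα1 : α < 1) (ht : 0 < t) (hτ : 0 ≤ τ)
    (h : τ ≤ t) : t ^ α - τ ^ α ≤ t ^ (α - 1) * (t - τ) := by
  have h1 : t ^ (α - 1) * t = t ^ α := by
    rw [← Real.rpow_add_one ht.ne', sub_add_cancel]
  rcases hτ.eq_or_lt with rfl | h0
  · have : 0 ≤ (0 : ℝ) ^ α := Real.rpow_nonneg le_rfl _
    rw [sub_zero, h1]
    linarith
  · have h2 : τ ^ (α - 1) * τ = τ ^ α := by
      rw [← Real.rpow_add_one h0.ne', sub_add_cancel]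
    have h3 : t ^ (α - 1) ≤ τ ^ (α - 1) := Real.rpow_le_rpow_of_nonpos h0 h (by linarith)
    rw [mul_sub, h1]
    nlinarith

section WeaklySingular

variable {E : Type*} [NormedAddCommGroup E] [NormedSpace ℝ E] {u : ℝ → E} {α C T : ℝ}

theorem intervalIntegrable_deriv_of_le_rpow (hα : 0 < α) (hd : ContinuousOn (deriv u) (Ioi 0))
    (hb : ∀ t, 0 < t → t ≤ T → ‖deriv u t‖ ≤ C * t ^ (α - 1)) {τ t : ℝ} (hτ : 0 ≤ τ)
    (h : τ ≤ t) (hT : t ≤ T) : IntervalIntegrable (deriv u) volume τ t := by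
  have h1 := (intervalIntegral.intervalIntegrable_rpow' (a := τ) (b := t)
    (show -1 < α - 1 by linarith)).const_mul C
  rw [intervalIntegrable_iff_integrableOn_Ioc_of_le h] at h1 ⊢
  refine Integrable.mono' h1 ?_ ?_
  · exact (hd.mono fun x hx => lt_of_le_of_lt hτ hx.1).aestronglyMeasurable measurableSet_Ioc
  · filter_upwards [ae_restrict_mem measurableSet_Ioc] with x hx
    exact hb x (lt_of_le_of_lt hτ hx.1) (hx.2.trans hT)

theorem norm_sub_le_rpow_sub_rpow [CompleteSpace E] (hα : 0 < α) (hc : ContinuousOn u (Ici 0))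
    (hu : ∀ t, 0 < t → DifferentiableAt ℝ u t) (hd : ContinuousOn (deriv u) (Ioi 0))
    (hb : ∀ t, 0 < t → t ≤ T → ‖deriv u t‖ ≤ C * t ^ (α - 1)) {τ t : ℝ} (hτ : 0 ≤ τ)
    (h : τ ≤ t) (hT : t ≤ T) : ‖u t - u τ‖ ≤ C / α * (t ^ α - τ ^ α) := by
  rw [← intervalIntegral.integral_eq_sub_of_hasDerivAt_of_le h
    (hc.mono fun x hx => hτ.trans hx.1)
    (fun x hx => (hu x (lt_of_le_of_lt hτ hx.1)).hasDerivAt)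
    (intervalIntegrable_deriv_of_le_rpow hα hd hb hτ h hT)]
  have e : C / α * (t ^ α - τ ^ α) = ∫ x in τ..t, C * x ^ (α - 1) := by
    rw [intervalIntegral.integral_const_mul, integral_rpow (Or.inl (by linarith)), sub_add_cancel]
    ring
  rw [e]
  refine intervalIntegral.norm_integral_le_of_norm_le h (ae_of_all _ fun x hx => ?_)
    ((intervalIntegral.intervalIntegrable_rpow' (by linarith)).const_mul C)
  exact hb x (lt_of_le_of_lt hτ hx.1) (hx.2.trans hT)

theorem const_nonneg_of_le_rpow (hT : 0 < T)
    (hb : ∀ t, 0 < t → t ≤ T → ‖deriv u t‖ ≤ C * t ^ (α - 1)) : 0 ≤ C := by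
  have := (norm_nonneg _).trans (hb T hT le_rfl)
  exact nonneg_of_mul_nonneg_left this (Real.rpow_pos_of_pos hT _)

theorem caputoAdmissible_of_deriv_le [CompleteSpace E] (hα : 0 < α) (hα1 : α < 1)
    (hc : ContinuousOn u (Ici 0)) (hu : ∀ t, 0 < t → DifferentiableAt ℝ u t)
    (hd : ContinuousOn (deriv u) (Ioi 0))
    (hb : ∀ T, 0 < T → ∃ C, ∀ t, 0 < t → t ≤ T → ‖deriv u t‖ ≤ C * t ^ (α - 1)) :
    CaputoAdmissible u := by
  refine ⟨hc.mono Ioi_subset_Ici_self, fun t ht => ?_⟩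
  obtain ⟨C, hC⟩ := hb t ht
  have hC0 := const_nonneg_of_le_rpow ht hC
  refine ⟨C / α * t ^ (α - 1), fun τ h h' => ?_⟩
  refine (norm_sub_le_rpow_sub_rpow hα hc hu hd hC h h' le_rfl).trans ?_
  rw [mul_assoc]
  exact mul_le_mul_of_nonneg_left (rpow_sub_rpow_le_mul hα1 ht h h') (by positivity)

/-- Each half of `[0, t]` contains only one of the two singularities; the other factor is bounded by
its value at `t / 2`. -/
theorem kernel_mul_rpow_le {t τ : ℝ} (hα : 0 < α) (hα1 : α < 1) (hτ : 0 < τ) (h : τ < t) :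
    (t - τ) ^ (-α) * τ ^ (α - 1) ≤
      (t / 2) ^ (-α) * τ ^ (α - 1) + (t / 2) ^ (α - 1) * (t - τ) ^ (-α) := by
  have h1 : 0 < t - τ := by linarith
  have h2 : 0 < t / 2 := by linarith
  have p1 : 0 < τ ^ (α - 1) := Real.rpow_pos_of_pos hτ _
  have p2 : 0 < (t - τ) ^ (-α) := Real.rpow_pos_of_pos h1 _
  have p3 : 0 < (t / 2) ^ (-α) := Real.rpow_pos_of_pos h2 _
  have p4 : 0 < (t / 2) ^ (α - 1) := Real.rpow_pos_of_pos h2 _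
  rcases le_total τ (t / 2) with h3 | h3
  · have : (t - τ) ^ (-α) ≤ (t / 2) ^ (-α) :=
      Real.rpow_le_rpow_of_nonpos h2 (by linarith) (by linarith)
    nlinarith [mul_pos p4 p2]
  · have : τ ^ (α - 1) ≤ (t / 2) ^ (α - 1) :=
      Real.rpow_le_rpow_of_nonpos h2 (by linarith) (by linarith)
    nlinarith [mul_pos p3 p1]

theorem intervalIntegrable_kernel_bound {t : ℝ} (hα : 0 < α) (hα1 : α < 1) :
    IntervalIntegrable (fun τ => C * ((t / 2) ^ (-α) * τ ^ (α - 1) +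
      (t / 2) ^ (α - 1) * (t - τ) ^ (-α))) volume 0 t :=
  (((intervalIntegral.intervalIntegrable_rpow' (by linarith)).const_mul _).add
    ((intervalIntegrable_sub_rpow (by linarith) _).const_mul _)).const_mul _

theorem norm_kernel_smul_deriv_le (hα : 0 < α) (hα1 : α < 1) {t : ℝ}
    (hb : ∀ s, 0 < s → s ≤ t → ‖deriv u s‖ ≤ C * s ^ (α - 1)) {τ : ℝ} (hτ : 0 < τ) (h : τ ≤ t) :
    ‖(t - τ) ^ (-α) • deriv u τ‖ ≤
      C * ((t / 2) ^ (-α) * τ ^ (α - 1) + (t / 2) ^ (α - 1) * (t - τ) ^ (-α)) := by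
  have hC := const_nonneg_of_le_rpow (hτ.trans_le h) hb
  have ht : 0 < t := hτ.trans_le h
  rw [norm_smul, Real.norm_of_nonneg (Real.rpow_nonneg (sub_nonneg.2 h) _)]
  rcases h.eq_or_lt with rfl | h'
  · rw [sub_self, Real.zero_rpow (by linarith : -α ≠ 0)]
    simp only [zero_mul, mul_zero, add_zero]
    positivity
  · calc _ ≤ (t - τ) ^ (-α) * (C * τ ^ (α - 1)) :=
          mul_le_mul_of_nonneg_left (hb τ hτ h) (Real.rpow_nonneg (sub_nonneg.2 h) _)
      _ = C * ((t - τ) ^ (-α) * τ ^ (α - 1)) := by ring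
      _ ≤ _ := mul_le_mul_of_nonneg_left (kernel_mul_rpow_le hα hα1 hτ h') hC

theorem intervalIntegrable_kernel_smul_deriv (hα : 0 < α) (hα1 : α < 1) {t : ℝ} (ht : 0 < t)
    (hd : ContinuousOn (deriv u) (Ioi 0))
    (hb : ∀ s, 0 < s → s ≤ t → ‖deriv u s‖ ≤ C * s ^ (α - 1)) :
    IntervalIntegrable (fun τ => (t - τ) ^ (-α) • deriv u τ) volume 0 t := by
  have h1 := intervalIntegrable_kernel_bound (C := C) (t := t) hα hα1
  rw [intervalIntegrable_iff_integrableOn_Ioc_of_le ht.le] at h1 ⊢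
  refine Integrable.mono' h1 ?_ ?_
  · refine AEStronglyMeasurable.smul ?_
      ((hd.mono fun x hx => hx.1).aestronglyMeasurable measurableSet_Ioc)
    exact (by fun_prop : Measurable fun τ : ℝ => (t - τ) ^ (-α)).aestronglyMeasurable
  · filter_upwards [ae_restrict_mem measurableSet_Ioc] with x hx
    exact norm_kernel_smul_deriv_le hα hα1 hb hx.1 hx.2

/-- The powers of `t` cancel, so the Caputo derivative stays bounded down to time `0`; this controls
the energy there. -/
theorem norm_integral_kernel_smul_deriv_le (hα : 0 < α) (hα1 : α < 1) {t : ℝ} (ht : 0 < t)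
    (hb : ∀ s, 0 < s → s ≤ t → ‖deriv u s‖ ≤ C * s ^ (α - 1)) :
    ‖∫ τ in (0 : ℝ)..t, (t - τ) ^ (-α) • deriv u τ‖ ≤
      C * (2 ^ α / α + 2 ^ (1 - α) / (1 - α)) := by
  have h := intervalIntegral.norm_integral_le_of_norm_le ht.le
    (ae_of_all _ fun τ hτ => norm_kernel_smul_deriv_le hα hα1 hb hτ.1 hτ.2)
    (intervalIntegrable_kernel_bound (C := C) hα hα1)
  refine h.trans (le_of_eq ?_)
  have hα1' : 1 - α ≠ 0 := by linarith
  rw [intervalIntegral.integral_const_mul, intervalIntegral.integral_add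
    ((intervalIntegral.intervalIntegrable_rpow' (by linarith)).const_mul _)
    ((intervalIntegrable_sub_rpow (by linarith) _).const_mul _),
    intervalIntegral.integral_const_mul, intervalIntegral.integral_const_mul,
    integral_sub_rpow (by linarith), integral_rpow (Or.inl (by linarith)), sub_add_cancel,
    sub_zero, Real.zero_rpow hα.ne', sub_zero, neg_add_eq_sub]
  have e1 : (t / 2) ^ (-α) * t ^ α = 2 ^ α := by
    rw [Real.div_rpow ht.le zero_le_two, div_mul_eq_mul_div, ← Real.rpow_add ht,
      neg_add_cancel, Real.rpow_zero, Real.rpow_neg zero_le_two, one_div, inv_inv]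
  have e2 : (t / 2) ^ (α - 1) * t ^ (1 - α) = 2 ^ (1 - α) := by
    rw [Real.div_rpow ht.le zero_le_two, div_mul_eq_mul_div, ← Real.rpow_add ht,
      show α - 1 + (1 - α) = 0 by ring, Real.rpow_zero, one_div, ← Real.rpow_neg zero_le_two,
      neg_sub]
  rw [← mul_div_assoc, ← mul_div_assoc, e1, e2]

/-- Integration by parts in the Caputo derivative. -/
theorem integral_kernel_smul_deriv [CompleteSpace E] (hα : 0 < α) (hα1 : α < 1)
    (hc : ContinuousOn u (Ici 0)) (hu : ∀ t, 0 < t → DifferentiableAt ℝ u t)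
    (hd : ContinuousOn (deriv u) (Ioi 0))
    (hb : ∀ T, 0 < T → ∃ C, ∀ t, 0 < t → t ≤ T → ‖deriv u t‖ ≤ C * t ^ (α - 1)) {t : ℝ}
    (ht : 0 < t) :
    ∫ τ in (0 : ℝ)..t, (t - τ) ^ (-α) • deriv u τ = ∫ τ, (u t - u τ) ∂caputoMeasure α t := by
  have hadm := caputoAdmissible_of_deriv_le hα hα1 hc hu hd hb
  obtain ⟨C, hC⟩ := hb t ht
  obtain ⟨K, hK⟩ := hadm.lipschitzAt t ht
  have hint := hadm.integrable hα hα1 ht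
  have hi1 := intervalIntegrable_kernel_smul_deriv hα hα1 ht hd hC
  have hi2 : IntervalIntegrable (fun τ => α • ((t - τ) ^ (-α - 1) • (u t - u τ))) volume 0 t :=
    (intervalIntegrable_of_integrable_caputoMeasure hα ht hint).smul α
  -- At `τ = t` the singular kernel is beaten by the Lipschitz bound, leaving `K (t - τ)^(1-α) → 0`.
  -- The boundary value at `0` produces the Dirac part of the measure.
  have hcont : ContinuousOn (fun τ => (t - τ) ^ (-α) • (u τ - u t)) (Icc 0 t) := by
    intro τ hτ
    rcases hτ.2.eq_or_lt with rfl | hlt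
    · rw [ContinuousWithinAt, sub_self (u τ), smul_zero]
      have hz : Tendsto (fun x => K * (τ - x) ^ (1 - α)) (𝓝[Icc 0 τ] τ) (𝓝 0) := by
        have : ContinuousAt (fun x => K * (τ - x) ^ (1 - α)) τ := by
          refine continuousAt_const.mul (ContinuousAt.rpow_const (by fun_prop) (Or.inr ?_))
          linarith
        have h2 : K * (τ - τ) ^ (1 - α) = 0 := by
          rw [sub_self, Real.zero_rpow (by linarith : 1 - α ≠ 0), mul_zero]
        rw [← h2]
        exact this.tendsto.mono_left nhdsWithin_le_nhds
      refine squeeze_zero_norm' ?_ hz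
      filter_upwards [self_mem_nhdsWithin] with x hx
      rw [norm_smul, Real.norm_of_nonneg (Real.rpow_nonneg (sub_nonneg.2 hx.2) _), norm_sub_rev]
      rcases hx.2.eq_or_lt with rfl | hx2
      · simp [Real.zero_rpow (by linarith : 1 - α ≠ 0)]
      · have hp : 0 < τ - x := sub_pos.2 hx2
        calc (τ - x) ^ (-α) * ‖u τ - u x‖ ≤ (τ - x) ^ (-α) * (K * (τ - x)) :=
              mul_le_mul_of_nonneg_left (hK x hx.1 hx.2) (Real.rpow_nonneg hp.le _)
          _ = K * (τ - x) ^ (1 - α) := by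
              rw [show 1 - α = -α + 1 by ring, Real.rpow_add_one hp.ne']
              ring
    · refine ContinuousWithinAt.smul ?_ ?_
      · exact (ContinuousAt.rpow_const (by fun_prop)
          (Or.inl (sub_pos.2 hlt).ne')).continuousWithinAt
      · exact ((hc τ hτ.1).mono Icc_subset_Ici_self).sub continuousWithinAt_const
  have hderiv : ∀ τ ∈ Ioo 0 t, HasDerivAt (fun τ => (t - τ) ^ (-α) • (u τ - u t))
      ((t - τ) ^ (-α) • deriv u τ - α • ((t - τ) ^ (-α - 1) • (u t - u τ))) τ := by
    intro τ hτ
    have h1 : HasDerivAt (fun x => (t - x) ^ (-α)) (-1 * (-α) * (t - τ) ^ (-α - 1)) τ :=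
      ((hasDerivAt_id τ).const_sub t).rpow_const (Or.inl (sub_pos.2 hτ.2).ne')
    have h2 := h1.smul ((hu τ hτ.1).hasDerivAt.sub_const (u t))
    refine h2.congr_deriv ?_
    rw [sub_eq_add_neg (_ • _), ← smul_neg, ← smul_neg, neg_sub, smul_smul, neg_mul_neg, one_mul]
  have key := intervalIntegral.integral_eq_sub_of_hasDerivAt_of_le ht.le hcont hderiv
    (hi1.sub hi2)
  rw [intervalIntegral.integral_sub hi1 hi2, intervalIntegral.integral_smul, sub_self t, sub_zero,
    sub_self (u t), smul_zero, zero_sub, sub_eq_iff_eq_add] at key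
  rw [key, integral_caputoMeasure hα ht hint, ← smul_neg, neg_sub]

end WeaklySingular

end

end TFCH

/-! ### The Cahn–Hilliard energy and solutions as fractional gradient flows. -/

namespace TFCH

noncomputable section

variable {d : ℕ} {Ω : Set (Space d)} {ε γ : ℝ}

theorem energy_nonneg (v : L2 Ω) : 0 ≤ energy Ω ε v :=
  add_nonneg (by positivity) (integral_nonneg fun x => by positivity)

theorem integrable_doubleWell (hΩb : Bornology.IsBounded Ω) {v f : L2 Ω}
    (hf : f =ᵐ[volume.restrict Ω] fun x => (v x) ^ 3 - v x) :
    Integrable (fun x => ((v x) ^ 2 - 1) ^ 2 / 4) (volume.restrict Ω) := by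
  have : IsFiniteMeasure (volume.restrict Ω) := isFiniteMeasure_restrict.2 hΩb.measure_lt_top.ne
  have h1 := MemLp.integrable_mul (Lp.memLp f) (Lp.memLp v)
  have h2 := MemLp.integrable_mul (Lp.memLp v) (Lp.memLp v)
  -- With `f = v³ - v` one has `(v² - 1)² = f v - v² + 1`, and every term is integrable.
  refine (((h1.sub h2).add (integrable_const (1 : ℝ))).div_const 4).congr ?_
  filter_upwards [hf] with x hx
  simp only [Pi.sub_apply, Pi.mul_apply, Pi.add_apply, hx]
  ring

/-- `F'' ≥ -1` makes `F(r) + r²/2` convex, while the Dirichlet part is exactly quadratic. The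
leftover `-ε²/2 ‖∇(a - b)‖²` is kept to absorb `‖a - b‖²/2` afterwards. -/
theorem energy_sub_le (hΩ : IsOpen Ω) (hΩb : Bornology.IsBounded Ω) {a b μ : L2 Ω}
    (ha : IsChemicalPotential Ω ε a μ) (hb : MemH10 Ω b)
    (hFb : Integrable (fun x => ((b x) ^ 2 - 1) ^ 2 / 4) (volume.restrict Ω)) :
    energy Ω ε a - energy Ω ε b ≤
      inner ℝ μ (a - b) - ε ^ 2 / 2 * ‖grad Ω (a - b)‖ ^ 2 + 1 / 2 * ‖a - b‖ ^ 2 := by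
  obtain ⟨haH, f, hf, hμ⟩ := ha
  have hFa := integrable_doubleWell hΩb hf
  rw [hμ _ (haH.sub hb), grad_sub hΩ haH hb]
  have h1 : (∫ x in Ω, ((a x) ^ 2 - 1) ^ 2 / 4) - (∫ x in Ω, ((b x) ^ 2 - 1) ^ 2 / 4) ≤
      inner ℝ f (a - b) + 1 / 2 * ‖a - b‖ ^ 2 := by
    rw [← integral_sub hFa hFb, ← real_inner_self_eq_norm_sq, L2.inner_def, L2.inner_def,
      ← integral_const_mul, ← integral_add (L2.integrable_inner _ _)
        ((L2.integrable_inner _ _).const_mul _)]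
    refine integral_mono_ae (hFa.sub hFb) ((L2.integrable_inner _ _).add
      ((L2.integrable_inner _ _).const_mul _)) ?_
    filter_upwards [hf, Lp.coeFn_sub a b] with x hx hx2
    simp only [hx, hx2, Pi.sub_apply, RCLike.inner_apply, conj_trivial]
    -- The two sides differ by `(a - b)² ((a + b)² + 2a²) / 4`.
    nlinarith [mul_nonneg (sq_nonneg (a x - b x)) (sq_nonneg (a x + b x)),
      mul_nonneg (sq_nonneg (a x - b x)) (sq_nonneg (a x)),
      mul_nonneg (sq_nonneg (a x - b x)) (sq_nonneg (b x))]
  have h2 : ε ^ 2 / 2 * ‖grad Ω a‖ ^ 2 - ε ^ 2 / 2 * ‖grad Ω b‖ ^ 2 =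
      ε ^ 2 * inner ℝ (grad Ω a) (grad Ω a - grad Ω b) -
        ε ^ 2 / 2 * ‖grad Ω a - grad Ω b‖ ^ 2 := by
    rw [norm_sub_sq_real, inner_sub_right, real_inner_self_eq_norm_sq]
    ring
  simp only [energy]
  linarith

/-- The energy is `λ`-convex with respect to the `H^{-1}` distance `‖A (a - b)‖`. -/
theorem IsCahnHilliardRHS.energy_sub_le (hΩ : IsOpen Ω) (hΩb : Bornology.IsBounded Ω)
    (hε : 0 < ε) (hγ : 0 < γ) {A : L2 Ω →L[ℝ] L2vec Ω} (hA : IsPoissonGrad Ω A) {a b g : L2 Ω}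
    (ha : IsCahnHilliardRHS Ω ε γ a g) (hb : MemH10 Ω b)
    (hFb : Integrable (fun x => ((b x) ^ 2 - 1) ^ 2 / 4) (volume.restrict Ω)) :
    energy Ω ε a - energy Ω ε b ≤
      -(1 / γ) * inner ℝ (A g) (A (a - b)) + 1 / (8 * ε ^ 2) * ‖A (a - b)‖ ^ 2 := by
  obtain ⟨μ, hμ, hμH, hg⟩ := ha
  have h1 := TFCH.energy_sub_le hΩ hΩb hμ hb hFb
  have hab := hμ.1.sub hb
  have h2 : A g = -γ • grad Ω μ := hA.eq_of_forall_inner hΩ hμH hg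
  have h3 : inner ℝ μ (a - b) = -(1 / γ) * inner ℝ (A g) (A (a - b)) := by
    rw [h2, real_inner_smul_left, ← mul_assoc, neg_mul_neg, one_div, inv_mul_cancel₀ hγ.ne',
      one_mul, real_inner_comm, real_inner_comm (A (a - b)), hA.inner_grad hΩ _ hμH]
  -- `L²` is interpolated between `H^{-1}` and `H₀¹`; completing the square against the leftover
  -- gradient term then produces the constant `1 / (8ε²)`.
  have h4 : ‖a - b‖ ^ 2 ≤ ‖A (a - b)‖ * ‖grad Ω (a - b)‖ := by
    rw [← real_inner_self_eq_norm_sq, ← hA.inner_grad hΩ _ hab]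
    exact real_inner_le_norm _ _
  have h5 : 1 / 2 * (‖A (a - b)‖ * ‖grad Ω (a - b)‖) ≤
      ε ^ 2 / 2 * ‖grad Ω (a - b)‖ ^ 2 + 1 / (8 * ε ^ 2) * ‖A (a - b)‖ ^ 2 := by
    have e : ε ^ 2 / 2 * ‖grad Ω (a - b)‖ ^ 2 + 1 / (8 * ε ^ 2) * ‖A (a - b)‖ ^ 2 -
        1 / 2 * (‖A (a - b)‖ * ‖grad Ω (a - b)‖) =
        1 / (8 * ε ^ 2) * (‖A (a - b)‖ - 2 * ε ^ 2 * ‖grad Ω (a - b)‖) ^ 2 := by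
      field_simp
      ring
    have : 0 ≤ 1 / (8 * ε ^ 2) * (‖A (a - b)‖ - 2 * ε ^ 2 * ‖grad Ω (a - b)‖) ^ 2 := by positivity
    linarith
  rw [h3] at h1
  linarith

theorem IsCahnHilliardRHS.integrable (hΩb : Bornology.IsBounded Ω) {a g : L2 Ω}
    (ha : IsCahnHilliardRHS Ω ε γ a g) :
    Integrable (fun x => ((a x) ^ 2 - 1) ^ 2 / 4) (volume.restrict Ω) := by
  obtain ⟨μ, ⟨_, f, hf, _⟩, _⟩ := ha
  exact integrable_doubleWell hΩb hf

/-- Fatou's lemma for the double-well energy along a sequence that converges in `L²(Ω)`. -/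
theorem integrable_doubleWell_of_tendsto {v : ℕ → L2 Ω} {v₀ : L2 Ω} (hv : Tendsto v atTop (𝓝 v₀))
    (hi : ∀ n, Integrable (fun x => ((v n x) ^ 2 - 1) ^ 2 / 4) (volume.restrict Ω)) {M : ℝ}
    (hM : ∀ n, energy Ω ε (v n) ≤ M) :
    Integrable (fun x => ((v₀ x) ^ 2 - 1) ^ 2 / 4) (volume.restrict Ω) := by
  obtain ⟨ns, hns, hae⟩ := (tendstoInMeasure_of_tendsto_Lp hv).exists_seq_tendsto_ae
  have hmeas : ∀ w : L2 Ω,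
      AEStronglyMeasurable (fun x => ((w x) ^ 2 - 1) ^ 2 / 4) (volume.restrict Ω) := fun w =>
    (by fun_prop : Continuous fun r : ℝ => (r ^ 2 - 1) ^ 2 / 4).comp_aestronglyMeasurable
      (Lp.aestronglyMeasurable w)
  refine ⟨hmeas v₀, ?_⟩
  rw [hasFiniteIntegral_iff_ofReal (ae_of_all _ fun x => by positivity)]
  have h1 : ∀ n, ∫⁻ x in Ω, ENNReal.ofReal (((v n x) ^ 2 - 1) ^ 2 / 4) ≤ ENNReal.ofReal M := by
    intro n
    rw [← ofReal_integral_eq_lintegral_ofReal (hi n) (ae_of_all _ fun x => by positivity)]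
    refine ENNReal.ofReal_le_ofReal (le_trans ?_ (hM n))
    exact le_add_of_nonneg_left (by positivity)
  calc ∫⁻ x in Ω, ENNReal.ofReal (((v₀ x) ^ 2 - 1) ^ 2 / 4)
      = ∫⁻ x in Ω, liminf (fun n => ENNReal.ofReal (((v (ns n) x) ^ 2 - 1) ^ 2 / 4)) atTop := by
        refine lintegral_congr_ae ?_
        filter_upwards [hae] with x hx
        refine (Tendsto.liminf_eq ?_).symm
        exact ENNReal.tendsto_ofReal (((hx.pow 2).sub_const 1).pow 2 |>.div_const 4)
    _ ≤ liminf (fun n => ∫⁻ x in Ω, ENNReal.ofReal (((v (ns n) x) ^ 2 - 1) ^ 2 / 4)) atTop :=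
        lintegral_liminf_le' fun n => (hmeas (v (ns n))).aemeasurable.ennreal_ofReal
    _ ≤ ENNReal.ofReal M := by
        refine (liminf_le_liminf (Eventually.of_forall fun n => h1 (ns n))).trans ?_
        simp
    _ < ⊤ := ENNReal.ofReal_lt_top

namespace IsGlobalSolution

variable {α : ℝ} {u : ℝ → L2 Ω}

theorem caputoAdmissible (h : IsGlobalSolution Ω ε γ α u) (hα : 0 < α) (hα1 : α < 1) :
    CaputoAdmissible u :=
  caputoAdmissible_of_deriv_le hα hα1 h.continuousOn h.differentiableAt h.continuousOn_deriv
    h.deriv_bound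

theorem integral_caputoMeasure_eq (h : IsGlobalSolution Ω ε γ α u) (hα : 0 < α) (hα1 : α < 1)
    {t : ℝ} (ht : 0 < t) :
    ∫ τ, (u t - u τ) ∂caputoMeasure α t = Real.Gamma (1 - α) • caputo α u t := by
  have hG : Real.Gamma (1 - α) ≠ 0 := (Real.Gamma_pos_of_pos (by linarith)).ne'
  rw [caputo, smul_smul, mul_inv_cancel₀ hG, one_smul, integral_kernel_smul_deriv hα hα1
    h.continuousOn h.differentiableAt h.continuousOn_deriv h.deriv_bound ht]

theorem exists_caputo_le (h : IsGlobalSolution Ω ε γ α u) (hα : 0 < α) (hα1 : α < 1) {T : ℝ}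
    (hT : 0 < T) : ∃ C, 0 ≤ C ∧ ∀ t, 0 < t → t ≤ T → ‖caputo α u t‖ ≤ C := by
  obtain ⟨C, hC⟩ := h.deriv_bound T hT
  have hC0 := const_nonneg_of_le_rpow hT hC
  have hG : 0 < Real.Gamma (1 - α) := Real.Gamma_pos_of_pos (by linarith)
  have hα1' : 0 < 1 - α := by linarith
  refine ⟨(Real.Gamma (1 - α))⁻¹ * (C * (2 ^ α / α + 2 ^ (1 - α) / (1 - α))), by positivity,
    fun t ht htT => ?_⟩
  rw [caputo, norm_smul, Real.norm_of_nonneg (by positivity)]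
  exact mul_le_mul_of_nonneg_left (norm_integral_kernel_smul_deriv_le hα hα1 ht
    fun s hs hst => hC s hs (hst.trans htT)) (by positivity)

theorem exists_energy_sub_le (h : IsGlobalSolution Ω ε γ α u) (hΩ : IsOpen Ω)
    (hΩb : Bornology.IsBounded Ω) (hε : 0 < ε) (hγ : 0 < γ) {A : L2 Ω →L[ℝ] L2vec Ω}
    (hA : IsPoissonGrad Ω A) (hα : 0 < α) (hα1 : α < 1) {T : ℝ} (hT : 0 < T) :
    ∃ L, 0 ≤ L ∧ ∀ a b, 0 < a → a ≤ T → 0 ≤ b →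
      Integrable (fun x => ((u b x) ^ 2 - 1) ^ 2 / 4) (volume.restrict Ω) →
      energy Ω ε (u a) - energy Ω ε (u b) ≤
        L * ‖A (u a - u b)‖ + 1 / (8 * ε ^ 2) * ‖A (u a - u b)‖ ^ 2 := by
  obtain ⟨C, hC, hCb⟩ := h.exists_caputo_le hα hα1 hT
  refine ⟨1 / γ * (‖A‖ * C), by positivity, fun a b ha haT hb hFb => ?_⟩
  have h1 := (h.equation a ha).energy_sub_le hΩ hΩb hε hγ hA (h.memH10 b hb) hFb
  have h2 := (abs_le.1 (abs_real_inner_le_norm (A (caputo α u a)) (A (u a - u b)))).1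
  have h3 : ‖A (caputo α u a)‖ ≤ ‖A‖ * C :=
    (A.le_opNorm _).trans (mul_le_mul_of_nonneg_left (hCb a ha haT) (norm_nonneg _))
  have h4 := mul_le_mul_of_nonneg_right h3 (norm_nonneg (A (u a - u b)))
  have h5 := mul_le_mul_of_nonneg_left (show -inner ℝ (A (caputo α u a)) (A (u a - u b)) ≤
    ‖A‖ * C * ‖A (u a - u b)‖ by linarith) (show 0 ≤ 1 / γ by positivity)
  linarith

theorem tendsto_zero (h : IsGlobalSolution Ω ε γ α u) : Tendsto u (𝓝[>] 0) (𝓝 (u 0)) :=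
  (h.continuousOn 0 self_mem_Ici).mono_left (nhdsWithin_mono _ Ioi_subset_Ici_self)

/-- At `t = 0` the equation gives nothing. Comparison with `u 1` bounds the energies of `u
(1/(n+1))`, and Fatou's lemma passes to the limit. Without integrability the integral in `energy`
would take its default value `0`. -/
theorem integrable_doubleWell (h : IsGlobalSolution Ω ε γ α u) (hΩ : IsOpen Ω)
    (hΩb : Bornology.IsBounded Ω) (hε : 0 < ε) (hγ : 0 < γ) {A : L2 Ω →L[ℝ] L2vec Ω}
    (hA : IsPoissonGrad Ω A) (hα : 0 < α) (hα1 : α < 1) {t : ℝ} (ht : 0 ≤ t) :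
    Integrable (fun x => ((u t x) ^ 2 - 1) ^ 2 / 4) (volume.restrict Ω) := by
  rcases ht.eq_or_lt with rfl | ht
  swap
  · exact (h.equation t ht).integrable hΩb
  obtain ⟨L, hL, hLb⟩ := h.exists_energy_sub_le hΩ hΩb hε hγ hA hα hα1 one_pos
  obtain ⟨R, hR⟩ := (isCompact_Icc (a := (0 : ℝ)) (b := 1)).exists_bound_of_continuousOn
    (h.continuousOn.mono Icc_subset_Ici_self)
  have hseq : Tendsto (fun n : ℕ => 1 / ((n : ℝ) + 1)) atTop (𝓝[>] 0) :=
    tendsto_nhdsWithin_iff.2 ⟨tendsto_one_div_add_atTop_nhds_zero_nat,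
      Eventually.of_forall fun n => by simp only [mem_Ioi]; positivity⟩
  have hpos : ∀ n : ℕ, 0 < 1 / ((n : ℝ) + 1) := fun n => by positivity
  have hle : ∀ n : ℕ, 1 / ((n : ℝ) + 1) ≤ 1 := fun n => by
    rw [div_le_one (by positivity)]
    linarith [n.cast_nonneg (α := ℝ)]
  refine integrable_doubleWell_of_tendsto (ε := ε) (h.tendsto_zero.comp hseq)
    (fun n => (h.equation _ (hpos n)).integrable hΩb)
    (M := energy Ω ε (u 1) + (L * (‖A‖ * (R + R)) + 1 / (8 * ε ^ 2) * (‖A‖ * (R + R)) ^ 2))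
    fun n => ?_
  have h1 := hLb _ 1 (hpos n) (hle n) zero_le_one ((h.equation 1 one_pos).integrable hΩb)
  have h2 : ‖A (u (1 / ((n : ℝ) + 1)) - u 1)‖ ≤ ‖A‖ * (R + R) := by
    refine (A.le_opNorm _).trans (mul_le_mul_of_nonneg_left ?_ (norm_nonneg _))
    exact (norm_sub_le _ _).trans (add_le_add (hR _ ⟨(hpos n).le, hle n⟩)
      (hR 1 ⟨zero_le_one, le_rfl⟩))
  have h3 := mul_le_mul_of_nonneg_left h2 hL
  have h4 := mul_le_mul_of_nonneg_left (pow_le_pow_left₀ (norm_nonneg _) h2 2)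
    (show 0 ≤ 1 / (8 * ε ^ 2) by positivity)
  simp only [Function.comp_apply]
  linarith

theorem caputoAdmissible_energy (h : IsGlobalSolution Ω ε γ α u) (hΩ : IsOpen Ω)
    (hΩb : Bornology.IsBounded Ω) (hε : 0 < ε) (hγ : 0 < γ) {A : L2 Ω →L[ℝ] L2vec Ω}
    (hA : IsPoissonGrad Ω A) (hα : 0 < α) (hα1 : α < 1) :
    CaputoAdmissible (fun t => energy Ω ε (u t)) := by
  have habs : ∀ T, 0 < T → ∃ L, 0 ≤ L ∧ ∀ a b, 0 < a → a ≤ T → 0 < b → b ≤ T →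
      |energy Ω ε (u a) - energy Ω ε (u b)| ≤
        L * ‖A (u a - u b)‖ + 1 / (8 * ε ^ 2) * ‖A (u a - u b)‖ ^ 2 := by
    intro T hT
    obtain ⟨L, hL, hLb⟩ := h.exists_energy_sub_le hΩ hΩb hε hγ hA hα hα1 hT
    refine ⟨L, hL, fun a b ha haT hb hbT => abs_le.2 ⟨?_, ?_⟩⟩
    · have := hLb b a hb hbT ha.le ((h.equation a ha).integrable hΩb)
      rw [← neg_sub (u a), map_neg, norm_neg] at this
      linarith
    · exact hLb a b ha haT hb.le ((h.equation b hb).integrable hΩb)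
  refine ⟨fun t ht => ContinuousAt.continuousWithinAt ?_, fun t ht => ?_⟩
  · have ht0 : 0 < t := ht
    obtain ⟨L, hL, hLb⟩ := habs (2 * t) (by positivity)
    rw [ContinuousAt, tendsto_iff_norm_sub_tendsto_zero]
    have hu : Tendsto (fun s => ‖A (u s - u t)‖) (𝓝 t) (𝓝 0) := by
      have h1 := (h.differentiableAt t ht0).continuousAt.tendsto
      have h2 := (A.continuous.tendsto _).comp (h1.sub_const (u t))
      rw [sub_self, map_zero] at h2
      simpa using h2.norm
    have hz : Tendsto (fun s => L * ‖A (u s - u t)‖ + 1 / (8 * ε ^ 2) * ‖A (u s - u t)‖ ^ 2)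
        (𝓝 t) (𝓝 0) := by
      have := (hu.const_mul L).add ((hu.pow 2).const_mul (1 / (8 * ε ^ 2)))
      rwa [zero_pow two_ne_zero, mul_zero, mul_zero, add_zero] at this
    refine squeeze_zero' (Eventually.of_forall fun s => norm_nonneg _) ?_ hz
    filter_upwards [Ioo_mem_nhds ht0 (show t < 2 * t by linarith)] with s hs
    exact hLb s t hs.1 hs.2.le ht0 (by linarith)
  · obtain ⟨L, hL, hLb⟩ := habs t ht
    obtain ⟨K, hK⟩ := (h.caputoAdmissible hα hα1).lipschitzAt t ht
    have hK0 : 0 ≤ K := by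
      have := (norm_nonneg _).trans (hK 0 le_rfl ht.le)
      rw [sub_zero] at this
      exact nonneg_of_mul_nonneg_left this ht
    set X := L * (‖A‖ * K) + 1 / (8 * ε ^ 2) * ((‖A‖ * K) ^ 2 * t) with hX
    -- The energy is not shown to be continuous at time `0`; `Y` covers the single point `τ = 0`, at
    -- distance `t` from `t`.
    set Y := |energy Ω ε (u t) - energy Ω ε (u 0)| / t with hY
    have hX0 : 0 ≤ X := by positivity
    have hY0 : 0 ≤ Y := by positivity
    refine ⟨X + Y, fun τ h0 h1 => ?_⟩
    have hd : 0 ≤ t - τ := sub_nonneg.2 h1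
    rcases h0.eq_or_lt with rfl | h0
    · rw [sub_zero, Real.norm_eq_abs, add_mul, hY, div_mul_cancel₀ _ ht.ne']
      exact le_add_of_nonneg_left (by positivity)
    · have h2 := hLb t τ ht le_rfl h0 h1
      have h3 : ‖A (u t - u τ)‖ ≤ ‖A‖ * K * (t - τ) := by
        rw [mul_assoc]
        exact (A.le_opNorm _).trans (mul_le_mul_of_nonneg_left (hK τ h0.le h1) (norm_nonneg _))
      have h4 : ‖A (u t - u τ)‖ ^ 2 ≤ (‖A‖ * K) ^ 2 * t * (t - τ) := by
        calc _ ≤ (‖A‖ * K * (t - τ)) ^ 2 := pow_le_pow_left₀ (norm_nonneg _) h3 2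
          _ = (‖A‖ * K) ^ 2 * (t - τ) * (t - τ) := by ring
          _ ≤ _ := by
            refine mul_le_mul_of_nonneg_right (mul_le_mul_of_nonneg_left ?_ (by positivity)) hd
            linarith
      have h5 := mul_le_mul_of_nonneg_left h3 hL
      have h6 := mul_le_mul_of_nonneg_left h4 (show 0 ≤ 1 / (8 * ε ^ 2) by positivity)
      have h7 : 0 ≤ Y * (t - τ) := by positivity
      rw [Real.norm_eq_abs, add_mul, hX]
      linarith

theorem caputoAdmissible_clm (h : IsGlobalSolution Ω ε γ α u) (A : L2 Ω →L[ℝ] L2vec Ω)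
    (hα : 0 < α) (hα1 : α < 1) : CaputoAdmissible (fun t => A (u t - u 0)) := by
  have hu := h.caputoAdmissible hα hα1
  refine ⟨A.continuous.comp_continuousOn (hu.continuousOn.sub continuousOn_const),
    fun t ht => ?_⟩
  obtain ⟨K, hK⟩ := hu.lipschitzAt t ht
  refine ⟨‖A‖ * K, fun τ h0 h1 => ?_⟩
  rw [← map_sub, sub_sub_sub_cancel_right, mul_assoc]
  exact (A.le_opNorm _).trans (mul_le_mul_of_nonneg_left (hK τ h0 h1) (norm_nonneg _))

/-- A solution of the time-fractional Cahn--Hilliard equation is a fractional gradient flow in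
`H^{-1}(Ω)`. -/
theorem isFractionalFlow (h : IsGlobalSolution Ω ε γ α u) (hΩ : IsOpen Ω)
    (hΩb : Bornology.IsBounded Ω) (hε : 0 < ε) (hγ : 0 < γ) {A : L2 Ω →L[ℝ] L2vec Ω}
    (hA : IsPoissonGrad Ω A) (hα : 0 < α) (hα1 : α < 1) :
    IsFractionalFlow α (1 / (8 * ε ^ 2)) γ (fun t => A (u t - u 0)) (fun t => A (caputo α u t))
      (fun t => energy Ω ε (u t) + 1 / (8 * ε ^ 2) * ‖A (u t - u 0)‖ ^ 2) := by
  have hκ : 0 ≤ 1 / (8 * ε ^ 2) := by positivity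
  have hV := h.caputoAdmissible_clm A hα hα1
  have hV0 : Tendsto (fun t => A (u t - u 0)) (𝓝[>] 0) (𝓝 0) := by
    have h2 := (A.continuous.tendsto _).comp (h.tendsto_zero.sub_const (u 0))
    rw [sub_self, map_zero] at h2
    exact h2
  have hdiff : ∀ a b, A (u a - u 0) - A (u b - u 0) = A (u a - u b) := fun a b => by
    rw [← map_sub, sub_sub_sub_cancel_right]
  refine ⟨hV, by simp, hV0,
    (h.caputoAdmissible_energy hΩ hΩb hε hγ hA hα hα1).add (hV.norm_sq.const_mul hκ), ?_, ?_, ?_,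
    ?_⟩
  · obtain ⟨L, hL, hLb⟩ := h.exists_energy_sub_le hΩ hΩb hε hγ hA hα hα1 one_pos
    have hz : Tendsto (fun t => L * ‖A (u t - u 0)‖ + 1 / (8 * ε ^ 2) * ‖A (u t - u 0)‖ ^ 2 +
        1 / (8 * ε ^ 2) * ‖A (u t - u 0)‖ ^ 2) (𝓝[>] 0) (𝓝 0) := by
      have := ((hV0.norm.const_mul L).add ((hV0.norm.pow 2).const_mul (1 / (8 * ε ^ 2)))).add
        ((hV0.norm.pow 2).const_mul (1 / (8 * ε ^ 2)))
      simpa using this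
    filter_upwards [hz.eventually_le_const one_pos, Ioo_mem_nhdsGT one_pos] with t h1 h2
    have h3 := hLb t 0 h2.1 h2.2.le le_rfl (h.integrable_doubleWell hΩ hΩb hε hγ hA hα hα1 le_rfl)
    simp only [sub_self, map_zero, norm_zero]
    linarith
  · intro t ht
    simp only [hdiff]
    rw [A.integral_comp_comm ((h.caputoAdmissible hα hα1).integrable hα hα1 ht),
      h.integral_caputoMeasure_eq hα hα1 ht, map_smul]
  · intro t _
    exact le_add_of_nonneg_left (energy_nonneg _)
  · intro a b ha hb
    have h1 := (h.equation a ha).energy_sub_le hΩ hΩb hε hγ hA (h.memH10 b hb)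
      (h.integrable_doubleWell hΩ hΩb hε hγ hA hα hα1 hb)
    -- This identity turns semiconvexity of the energy into the subgradient inequality for the
    -- energy plus `κ‖V‖²`.
    have h2 : ‖A (u a - u b)‖ ^ 2 + ‖A (u a - u 0)‖ ^ 2 - ‖A (u b - u 0)‖ ^ 2 =
        2 * inner ℝ (A (u a - u 0)) (A (u a - u 0) - A (u b - u 0)) := by
      rw [← hdiff, norm_sub_sq_real, inner_sub_right, real_inner_self_eq_norm_sq]
      ring
    simp only [inner_add_left, real_inner_smul_left]
    rw [hdiff] at h2 ⊢
    have h3 := congrArg (fun r => 1 / (8 * ε ^ 2) * r) h2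
    linarith

end IsGlobalSolution

end

end TFCH

/-! ### Bounds and limits of the memory term. -/

namespace TFCH

noncomputable section

variable {d : ℕ} {Ω : Set (Space d)} {ε γ α : ℝ} {u Ψ : ℝ → L2 Ω} {A : L2 Ω →L[ℝ] L2vec Ω}

theorem modifiedEnergy_sub_energy (t : ℝ) :
    modifiedEnergy Ω ε γ α u Ψ t - energy Ω ε (u t) =
      1 / (γ * Real.Gamma (1 - α)) * memoryTerm Ω α Ψ t :=
  add_sub_cancel_left _ _

theorem IsPotential.memoryIntegrand_eq (hΨ : IsPotential Ω u Ψ) (hΩ : IsOpen Ω)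
    (hA : IsPoissonGrad Ω A) {t τ : ℝ} (ht : 0 ≤ t) (hτ : 0 ≤ τ) :
    memoryIntegrand Ω α Ψ t τ = ‖A (u t - u τ)‖ ^ 2 / (t - τ) ^ (α + 1) := by
  rw [memoryIntegrand, hΨ.grad_sub_eq hΩ hA ht hτ, ← map_sub, sub_sub_sub_cancel_right]

theorem memoryTerm_zero (hΨ : IsPotential Ω u Ψ) (hΩ : IsOpen Ω) (hA : IsPoissonGrad Ω A) :
    memoryTerm Ω α Ψ 0 = 0 := by
  rw [memoryTerm, (hΨ 0 le_rfl).grad_eq_apply hΩ hA]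
  simp

theorem memoryTerm_nonneg (hα : 0 ≤ α) {t : ℝ} (ht : 0 ≤ t) : 0 ≤ memoryTerm Ω α Ψ t := by
  refine add_nonneg (by positivity) (mul_nonneg (by positivity) ?_)
  rw [intervalIntegral.integral_of_le ht]
  refine setIntegral_nonneg measurableSet_Ioc fun τ hτ => ?_
  exact div_nonneg (sq_nonneg _) (Real.rpow_nonneg (sub_nonneg.2 hτ.2) _)

theorem sq_div_rpow_le {x H s : ℝ} (hα : α < 1) (hx : 0 ≤ x) (hs : 0 ≤ s) (h : x ≤ H * s ^ α) :
    x ^ 2 / s ^ (α + 1) ≤ H ^ 2 * s ^ (α - 1) := by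
  rcases hs.eq_or_lt with rfl | hs
  · have h1 : α - 1 ≠ 0 := by linarith
    rw [Real.zero_rpow h1, mul_zero]
    by_cases hα0 : α + 1 = 0
    · have h2 : α ≠ 0 := by intro h3; linarith
      rw [Real.zero_rpow h2, mul_zero] at h
      rw [le_antisymm h hx]
      simp
    · rw [Real.zero_rpow hα0, div_zero]
  · rw [div_le_iff₀ (Real.rpow_pos_of_pos hs _)]
    calc x ^ 2 ≤ (H * s ^ α) ^ 2 := pow_le_pow_left₀ hx h 2
      _ = H ^ 2 * s ^ (α - 1) * s ^ (α + 1) := by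
        rw [mul_assoc, ← Real.rpow_add hs, mul_pow, ← Real.rpow_mul_natCast hs.le]
        congr 2
        push_cast
        ring

theorem IsPotential.intervalIntegrable_memoryIntegrand (hΨ : IsPotential Ω u Ψ) (hΩ : IsOpen Ω)
    (hA : IsPoissonGrad Ω A) (hu : ContinuousOn u (Ici 0)) (hα : 0 < α) (hα1 : α < 1) {t H : ℝ}
    (ht : 0 < t) (hH : ∀ τ, 0 ≤ τ → τ ≤ t → ‖A (u t - u τ)‖ ≤ H * (t - τ) ^ α) :
    IntervalIntegrable (memoryIntegrand Ω α Ψ t) volume 0 t := by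
  have h1 := (intervalIntegrable_sub_rpow (t := t) (r := α - 1) (by linarith) 0).const_mul (H ^ 2)
  rw [intervalIntegrable_iff_integrableOn_Ioc_of_le ht.le] at h1 ⊢
  refine IntegrableOn.congr_fun (f := fun τ => ‖A (u t - u τ)‖ ^ 2 / (t - τ) ^ (α + 1)) ?_
    (fun τ hτ => (hΨ.memoryIntegrand_eq hΩ hA ht.le hτ.1.le).symm) measurableSet_Ioc
  refine Integrable.mono' h1 ?_ ?_
  · have hc : ContinuousOn (fun τ => ‖A (u t - u τ)‖ ^ 2) (Ioc 0 t) :=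
      (A.continuous.comp_continuousOn (continuousOn_const.sub
        (hu.mono fun x hx => hx.1.le))).norm.pow 2
    exact (hc.aemeasurable measurableSet_Ioc).aestronglyMeasurable.div₀
      (by fun_prop : Measurable fun τ : ℝ => (t - τ) ^ (α + 1)).aestronglyMeasurable
  · filter_upwards [ae_restrict_mem measurableSet_Ioc] with τ hτ
    have hs : 0 ≤ t - τ := sub_nonneg.2 hτ.2
    rw [Real.norm_of_nonneg (div_nonneg (sq_nonneg _) (Real.rpow_nonneg hs _))]
    exact sq_div_rpow_le hα1 (norm_nonneg _) hs (hH τ hτ.1.le hτ.2)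

/-- The boundary term and the integral term each contribute at most `H² t^α / 2`. -/
theorem IsPotential.memoryTerm_le (hΨ : IsPotential Ω u Ψ) (hΩ : IsOpen Ω)
    (hA : IsPoissonGrad Ω A) (hu : ContinuousOn u (Ici 0)) (hα : 0 < α) (hα1 : α < 1) {t H : ℝ}
    (ht : 0 < t) (hH : ∀ τ, 0 ≤ τ → τ ≤ t → ‖A (u t - u τ)‖ ≤ H * (t - τ) ^ α) :
    memoryTerm Ω α Ψ t ≤ H ^ 2 * t ^ α := by
  have hint := hΨ.intervalIntegrable_memoryIntegrand hΩ hA hu hα hα1 ht hH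
  have htα : 0 < t ^ α := Real.rpow_pos_of_pos ht _
  have h1 : ‖grad Ω (Ψ t)‖ ^ 2 / (2 * t ^ α) ≤ H ^ 2 * t ^ α / 2 := by
    rw [(hΨ t ht.le).grad_eq_apply hΩ hA, div_le_iff₀ (by positivity)]
    have h2 := hH 0 le_rfl ht.le
    rw [sub_zero] at h2
    calc _ ≤ (H * t ^ α) ^ 2 := pow_le_pow_left₀ (norm_nonneg _) h2 2
      _ = _ := by ring
  have h2 : ∫ τ in (0 : ℝ)..t, memoryIntegrand Ω α Ψ t τ ≤ H ^ 2 * (t ^ α / α) := by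
    have e : H ^ 2 * (t ^ α / α) = ∫ τ in (0 : ℝ)..t, H ^ 2 * (t - τ) ^ (α - 1) := by
      rw [intervalIntegral.integral_const_mul, integral_sub_rpow (by linarith), sub_add_cancel,
        sub_zero]
    rw [e]
    refine intervalIntegral.integral_mono_on ht.le hint
      ((intervalIntegrable_sub_rpow (by linarith) 0).const_mul _) fun τ hτ => ?_
    rw [hΨ.memoryIntegrand_eq hΩ hA ht.le hτ.1]
    exact sq_div_rpow_le hα1 (norm_nonneg _) (sub_nonneg.2 hτ.2) (hH τ hτ.1 hτ.2)
  have h3 := mul_le_mul_of_nonneg_left h2 (show 0 ≤ α / 2 by positivity)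
  have e : α / 2 * (H ^ 2 * (t ^ α / α)) = H ^ 2 * t ^ α / 2 := by field_simp
  rw [memoryTerm]
  linarith

theorem IsGlobalSolution.exists_holder (h : IsGlobalSolution Ω ε γ α u) (A : L2 Ω →L[ℝ] L2vec Ω)
    (hα : 0 < α) (hα1 : α < 1) {T : ℝ} (hT : 0 < T) :
    ∃ H, ∀ t τ, 0 ≤ τ → τ ≤ t → t ≤ T → ‖A (u t - u τ)‖ ≤ H * (t - τ) ^ α := by
  obtain ⟨C, hC⟩ := h.deriv_bound T hT
  have hC0 := const_nonneg_of_le_rpow hT hC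
  refine ⟨‖A‖ * (C / α), fun t τ h0 h1 h2 => ?_⟩
  rw [mul_assoc]
  refine (A.le_opNorm _).trans (mul_le_mul_of_nonneg_left ?_ (norm_nonneg _))
  refine (norm_sub_le_rpow_sub_rpow hα h.continuousOn h.differentiableAt h.continuousOn_deriv hC
    h0 h1 h2).trans ?_
  exact mul_le_mul_of_nonneg_left (rpow_sub_rpow_le_sub_rpow hα hα1 h0 h1) (by positivity)

theorem IsGlobalSolution.tendsto_memoryTerm_zero (h : IsGlobalSolution Ω ε γ α u)
    (hΨ : IsPotential Ω u Ψ) (hΩ : IsOpen Ω) (hA : IsPoissonGrad Ω A) (hα : 0 < α)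
    (hα1 : α < 1) : Tendsto (memoryTerm Ω α Ψ) (𝓝[>] 0) (𝓝 0) := by
  obtain ⟨H, hH⟩ := h.exists_holder A hα hα1 one_pos
  have hz : Tendsto (fun t : ℝ => H ^ 2 * t ^ α) (𝓝[>] 0) (𝓝 0) := by
    have : ContinuousAt (fun t : ℝ => H ^ 2 * t ^ α) 0 :=
      continuousAt_const.mul (continuousAt_id.rpow_const (Or.inr hα.le))
    have h2 := this.tendsto
    rw [Real.zero_rpow hα.ne', mul_zero] at h2
    exact h2.mono_left nhdsWithin_le_nhds
  refine squeeze_zero' ?_ ?_ hz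
  · filter_upwards [self_mem_nhdsWithin] with t ht using memoryTerm_nonneg hα.le (le_of_lt ht)
  · filter_upwards [Ioo_mem_nhdsGT one_pos] with t ht
    exact hΨ.memoryTerm_le hΩ hA h.continuousOn hα hα1 ht.1
      fun τ h0 h1 => hH t τ h0 h1 ht.2.le

theorem integrableOn_holder_bound (hα : 0 < α) (H M : ℝ) :
    IntegrableOn (fun s : ℝ => if s ≤ 1 then H ^ 2 * s ^ (α - 1) else M ^ 2 * s ^ (-(α + 1)))
      (Ioi 0) := by
  rw [← Ioc_union_Ioi_eq_Ioi (zero_le_one (α := ℝ))]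
  refine IntegrableOn.union ?_ ?_
  · have h1 := (intervalIntegral.intervalIntegrable_rpow' (a := 0) (b := 1)
      (show -1 < α - 1 by linarith)).const_mul (H ^ 2)
    rw [intervalIntegrable_iff_integrableOn_Ioc_of_le zero_le_one] at h1
    exact h1.congr_fun (fun s hs => (if_pos hs.2).symm) measurableSet_Ioc
  · have h1 := (integrableOn_Ioi_rpow_of_lt (show -(α + 1) < -1 by linarith) one_pos).const_mul
      (M ^ 2)
    exact IntegrableOn.congr_fun h1 (fun s hs => (if_neg (not_le.2 hs)).symm) measurableSet_Ioi

/-- After `τ = t - s`, extended by zero to `(0, ∞)`, the integrand is dominated by `H² s^(α-1)` for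
`s ≤ 1` and by `M² s^(-α-1)` for `s > 1`. -/
theorem tendsto_integral_holder (hα : 0 < α) (hα1 : α < 1) {N : ℝ → ℝ → ℝ}
    (hN : ∀ t τ, 0 ≤ N t τ) (hc : ∀ t, ContinuousOn (N t) (Ici 0)) {H M : ℝ}
    (hH : ∀ t τ, 0 ≤ τ → τ ≤ t → N t τ ≤ H * (t - τ) ^ α)
    (hM : ∀ t τ, 0 ≤ τ → 0 ≤ t → N t τ ≤ M)
    (hlim : ∀ s, 0 < s → Tendsto (fun t => N t (t - s)) atTop (𝓝 0)) :
    Tendsto (fun t => ∫ τ in (0 : ℝ)..t, N t τ ^ 2 / (t - τ) ^ (α + 1)) atTop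
      (𝓝 0) := by
  set F : ℝ → ℝ → ℝ := fun t =>
    (Ioc 0 t).indicator (fun s => N t (t - s) ^ 2 / s ^ (α + 1)) with hF
  have hFnonneg : ∀ t s, 0 ≤ F t s := fun t s =>
    indicator_nonneg (fun x hx => div_nonneg (sq_nonneg _) (Real.rpow_nonneg hx.1.le _)) s
  have hFle : ∀ t s, 0 < s → F t s ≤ N t (t - s) ^ 2 / s ^ (α + 1) := fun t s hs =>
    indicator_le_self' (fun _ _ => div_nonneg (sq_nonneg _) (Real.rpow_nonneg hs.le _)) s
  have key : Tendsto (fun t => ∫ s in Ioi 0, F t s) atTop (𝓝 (∫ s in Ioi (0 : ℝ), (0 : ℝ))) := by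
    refine tendsto_integral_filter_of_dominated_convergence _ ?_ ?_
      (integrableOn_holder_bound hα H M) ?_
    · filter_upwards with t
      rw [aestronglyMeasurable_indicator_iff measurableSet_Ioc,
        Measure.restrict_restrict measurableSet_Ioc]
      have hc' : ContinuousOn (fun s => N t (t - s) ^ 2) (Ioc 0 t) :=
        ((hc t).comp (by fun_prop) fun x hx => sub_nonneg.2 hx.2).pow 2
      have h1 := (hc'.aemeasurable (μ := volume) measurableSet_Ioc).aestronglyMeasurable.div₀
        (by fun_prop : Measurable fun s : ℝ => s ^ (α + 1)).aestronglyMeasurable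
      exact h1.mono_measure (Measure.restrict_mono inter_subset_left le_rfl)
    · filter_upwards with t
      filter_upwards [ae_restrict_mem measurableSet_Ioi] with s hs
      have hs0 : 0 < s := hs
      rw [Real.norm_of_nonneg (hFnonneg t s)]
      by_cases hst : s ∈ Ioc 0 t
      · rw [hF]
        simp only [indicator_of_mem hst]
        have h0 : 0 ≤ t - s := sub_nonneg.2 hst.2
        split_ifs with h1
        · refine sq_div_rpow_le hα1 (hN _ _) hs0.le ?_
          have := hH t (t - s) h0 (by linarith)
          rwa [sub_sub_cancel] at this
        · rw [Real.rpow_neg hs0.le, ← div_eq_mul_inv]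
          refine div_le_div_of_nonneg_right ?_ (by positivity)
          exact pow_le_pow_left₀ (hN _ _) (hM t (t - s) h0 (by linarith)) 2
      · rw [hF]
        simp only [indicator_of_notMem hst]
        split_ifs <;> positivity
    · filter_upwards [ae_restrict_mem measurableSet_Ioi] with s hs
      have hs0 : 0 < s := hs
      have h3 := ((hlim s hs0).pow 2).div_const (s ^ (α + 1))
      rw [zero_pow two_ne_zero, zero_div] at h3
      exact squeeze_zero (fun t => hFnonneg t s) (fun t => hFle t s hs0) h3
  rw [integral_zero] at key
  refine key.congr' ?_
  filter_upwards [eventually_ge_atTop 0] with t ht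
  have e := intervalIntegral.integral_comp_sub_left (a := 0) (b := t)
    (fun τ => N t τ ^ 2 / (t - τ) ^ (α + 1)) t
  rw [sub_self, sub_zero] at e
  rw [← e, intervalIntegral.integral_of_le ht, hF]
  simp only [sub_sub_cancel]
  rw [setIntegral_indicator measurableSet_Ioc, inter_eq_right.2 fun x hx => hx.1]

theorem IsGlobalSolution.tendsto_memoryTerm_atTop (h : IsGlobalSolution Ω ε γ α u)
    (hΨ : IsPotential Ω u Ψ) (hΩ : IsOpen Ω) (hA : IsPoissonGrad Ω A) (hα : 0 < α)
    (hα1 : α < 1) {R : ℝ} (hR : ∀ t, 0 ≤ t → ‖u t‖ ≤ R) {uinf : L2 Ω}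
    (hlim : Tendsto u atTop (𝓝 uinf)) {C : ℝ}
    (hC : ∀ t τ, 0 ≤ t → 0 ≤ τ → ‖u t - u τ‖ ≤ C * |t - τ| ^ α) :
    Tendsto (memoryTerm Ω α Ψ) atTop (𝓝 0) := by
  have hI := tendsto_integral_holder (N := fun t τ => ‖A (u t - u τ)‖) (H := ‖A‖ * C)
    (M := ‖A‖ * (R + R)) hα hα1 (fun t τ => norm_nonneg _)
    (fun t => (A.continuous.comp_continuousOn (continuousOn_const.sub h.continuousOn)).norm)
    (fun t τ h0 h1 => by
      rw [mul_assoc]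
      refine (A.le_opNorm _).trans (mul_le_mul_of_nonneg_left ?_ (norm_nonneg _))
      have := hC t τ (h0.trans h1) h0
      rwa [abs_of_nonneg (sub_nonneg.2 h1)] at this)
    (fun t τ h0 h1 => (A.le_opNorm _).trans (mul_le_mul_of_nonneg_left
      ((norm_sub_le _ _).trans (add_le_add (hR t h1) (hR τ h0))) (norm_nonneg _)))
    (fun s _ => by
      have h1 : Tendsto (fun t => u (t - s)) atTop (𝓝 uinf) :=
        hlim.comp (tendsto_atTop_add_const_right _ (-s) tendsto_id)
      have h2 := (A.continuous.tendsto _).comp (hlim.sub h1)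
      rw [sub_self, map_zero] at h2
      simpa using h2.norm)
  have h1 : Tendsto (fun t => ‖A (u t - u 0)‖ ^ 2 / (2 * t ^ α)) atTop (𝓝 0) := by
    have h2 := ((A.continuous.tendsto _).comp (hlim.sub_const (u 0))).norm.pow 2
    exact h2.div_atTop ((tendsto_rpow_atTop hα).const_mul_atTop two_pos)
  have h3 := h1.add (hI.const_mul (α / 2))
  rw [mul_zero, add_zero] at h3
  refine h3.congr' ?_
  filter_upwards [eventually_ge_atTop 0] with t ht
  rw [memoryTerm, (hΨ t ht).grad_eq_apply hΩ hA]
  congr 2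
  refine intervalIntegral.integral_congr fun τ hτ => ?_
  rw [uIcc_of_le ht] at hτ
  exact (hΨ.memoryIntegrand_eq hΩ hA ht hτ.1).symm

theorem tendsto_modifiedEnergy_sub_energy_order_one (hΩ : IsOpen Ω)
    (hΩb : Bornology.IsBounded Ω) (hε : 0 < ε) (hγ : 0 < γ) (hA : IsPoissonGrad Ω A) {u₀ : L2 Ω}
    {u Ψ : ℝ → ℝ → L2 Ω} (h : ∀ᶠ α in 𝓝[<] (1 : ℝ), IsGlobalSolution Ω ε γ α (u α) ∧
      u α 0 = u₀ ∧ IsPotential Ω (u α) (Ψ α)) {t : ℝ} (ht : 0 < t) :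
    Tendsto (fun α => modifiedEnergy Ω ε γ α (u α) (Ψ α) t - energy Ω ε (u α t))
      (𝓝[<] 1) (𝓝 0) := by
  obtain ⟨K, hK⟩ := exists_lipschitz_fractionalFlow (W := L2vec Ω) (E₀ := energy Ω ε u₀)
    (show 0 < 1 / (8 * ε ^ 2) by positivity) hγ ht
  have hev : ∀ᶠ α in 𝓝[<] (1 : ℝ), 1 / 2 ≤ α ∧ α < 1 := by
    filter_upwards [Ioo_mem_nhdsLT (show (1 / 2 : ℝ) < 1 by norm_num)] with α hα
    exact ⟨hα.1.le, hα.2⟩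
  -- Since `t - τ ≤ t^(1-α) (t - τ)^α`, the uniform Lipschitz constant `K` gives the Hölder constant
  -- `H = K t^(1-α)`. The resulting bound `H² t^α` stays bounded as `α → 1`, and `1 / Γ(1-α)` drives
  -- the product to `0`.
  have hz : Tendsto (fun α : ℝ => 1 / γ * (Real.Gamma (1 - α))⁻¹ * ((K * t ^ (1 - α)) ^ 2 * t ^ α))
      (𝓝[<] 1) (𝓝 0) := by
    have hc : ContinuousAt (fun α : ℝ => (K * t ^ (1 - α)) ^ 2 * t ^ α) 1 := by
      refine ContinuousAt.mul (ContinuousAt.pow (continuousAt_const.mul ?_) 2) ?_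
      · exact ContinuousAt.rpow continuousAt_const (by fun_prop) (Or.inl ht.ne')
      · exact ContinuousAt.rpow continuousAt_const continuousAt_id (Or.inl ht.ne')
    have := (tendsto_inv_Gamma_one_sub.const_mul (1 / γ)).mul
      (hc.tendsto.mono_left nhdsWithin_le_nhds)
    rwa [mul_zero, zero_mul] at this
  refine squeeze_zero' ?_ ?_ hz
  · filter_upwards [hev] with α hα
    have hG : 0 < Real.Gamma (1 - α) := Real.Gamma_pos_of_pos (by linarith [hα.2])
    rw [modifiedEnergy_sub_energy]
    exact mul_nonneg (by positivity) (memoryTerm_nonneg (by linarith [hα.1]) ht.le)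
  · filter_upwards [hev, h] with α hα hsol
    obtain ⟨hα, hα1⟩ := hα
    obtain ⟨hu, hu0, hΨ⟩ := hsol
    have hα0 : 0 < α := by linarith
    have hG : 0 < Real.Gamma (1 - α) := Real.Gamma_pos_of_pos (by linarith)
    have hKα := hK α _ _ _ hα hα1 (hu.isFractionalFlow hΩ hΩb hε hγ hA hα0 hα1)
      (by simp only [sub_self, map_zero, norm_zero, hu0]; ring)
    have hK0 : 0 ≤ K := by
      have := (norm_nonneg _).trans (hKα 0 le_rfl ht.le)
      rw [sub_zero] at this
      exact nonneg_of_mul_nonneg_left this ht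
    rw [modifiedEnergy_sub_energy, one_div, one_div, mul_inv]
    refine mul_le_mul_of_nonneg_left (hΨ.memoryTerm_le hΩ hA hu.continuousOn hα0 hα1 ht
      fun τ h0 h1 => ?_) (by positivity)
    have h2 := hKα τ h0 h1
    rw [← map_sub, sub_sub_sub_cancel_right] at h2
    refine h2.trans ?_
    rw [mul_assoc]
    refine mul_le_mul_of_nonneg_left ?_ hK0
    have hs : 0 ≤ t - τ := sub_nonneg.2 h1
    rcases hs.eq_or_lt with hs | hs
    · rw [← hs]
      positivity
    · calc t - τ = (t - τ) ^ (1 - α) * (t - τ) ^ α := by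
            rw [← Real.rpow_add hs, sub_add_cancel, Real.rpow_one]
        _ ≤ t ^ (1 - α) * (t - τ) ^ α :=
            mul_le_mul_of_nonneg_right
              (Real.rpow_le_rpow hs.le (by linarith) (by linarith)) (Real.rpow_nonneg hs.le _)

end

end TFCH

theorem mainTheorem11 (d : ℕ) (hd : 0 < d) (Ω : Set (TFCH.Space d)) (hΩ : IsOpen Ω)
    (hΩb : Bornology.IsBounded Ω) (ε γ : ℝ) (hε : 0 < ε) (hγ : 0 < γ) :
    (∀ α : ℝ, 0 < α → α < 1 → ∀ u Ψ : ℝ → TFCH.L2 Ω,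
      TFCH.IsGlobalBoundedSolution Ω ε γ α u → TFCH.IsPotential Ω u Ψ →
        (∀ t : ℝ, 0 < t →
          IntervalIntegrable (TFCH.memoryIntegrand Ω α Ψ t) volume 0 t) ∧
        (TFCH.modifiedEnergy Ω ε γ α u Ψ 0 = TFCH.energy Ω ε (u 0) ∧
          Tendsto (fun t => TFCH.modifiedEnergy Ω ε γ α u Ψ t - TFCH.energy Ω ε (u t))
            (𝓝[>] 0) (𝓝 0)) ∧
        ((∃ uinf : TFCH.L2 Ω, TFCH.IsSteadyState Ω ε γ uinf ∧ Tendsto u atTop (𝓝 uinf)) →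
          (∃ C : ℝ, 0 < C ∧ ∀ t τ : ℝ, 0 ≤ t → 0 ≤ τ → ‖u t - u τ‖ ≤ C * |t - τ| ^ α) →
          Tendsto (fun t => TFCH.modifiedEnergy Ω ε γ α u Ψ t - TFCH.energy Ω ε (u t))
            atTop (𝓝 0))) ∧
    (∀ (u₀ : TFCH.L2 Ω) (u Ψ : ℝ → ℝ → TFCH.L2 Ω),
      (∀ᶠ α in 𝓝[<] (1 : ℝ), TFCH.IsGlobalBoundedSolution Ω ε γ α (u α) ∧ u α 0 = u₀ ∧
        TFCH.IsPotential Ω (u α) (Ψ α)) →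
      ∀ t : ℝ, 0 < t →
        Tendsto (fun α => TFCH.modifiedEnergy Ω ε γ α (u α) (Ψ α) t - TFCH.energy Ω ε (u α t))
          (𝓝[<] 1) (𝓝 0)) := by
  obtain ⟨A, hA⟩ := TFCH.exists_isPoissonGrad hd hΩ hΩb
  refine ⟨fun α hα hα1 u Ψ hu hΨ => ⟨fun t ht => ?_, ⟨?_, ?_⟩, ?_⟩, fun u₀ u Ψ h t ht => ?_⟩
  · obtain ⟨H, hH⟩ := hu.1.exists_holder A hα hα1 ht
    exact hΨ.intervalIntegrable_memoryIntegrand hΩ hA hu.1.continuousOn hα hα1 ht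
      fun τ h0 h1 => hH t τ h0 h1 le_rfl
  · rw [TFCH.modifiedEnergy, TFCH.memoryTerm_zero hΨ hΩ hA, mul_zero, add_zero]
  · simp only [TFCH.modifiedEnergy_sub_energy]
    simpa using (hu.1.tendsto_memoryTerm_zero hΨ hΩ hA hα hα1).const_mul
      (1 / (γ * Real.Gamma (1 - α)))
  · rintro ⟨uinf, -, hlim⟩ ⟨C, -, hC⟩
    obtain ⟨R, hR⟩ := hu.2
    simp only [TFCH.modifiedEnergy_sub_energy]
    simpa using (hu.1.tendsto_memoryTerm_atTop hΨ hΩ hA hα hα1 hR hlim hC).const_mul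
      (1 / (γ * Real.Gamma (1 - α)))
  · refine TFCH.tendsto_modifiedEnergy_sub_energy_order_one hΩ hΩb hε hγ hA (u₀ := u₀) ?_ ht
    filter_upwards [h] with α hα
    exact ⟨hα.1.1, hα.2⟩
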